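/- For $g\in L^2(\mathbb R)$ and $\Lambda\subset\mathbb R$ let $\mathcal G(g,\Lambda\times\mathbb Z)=\{e^{2\pi i\lambda t}g(t-n):(\lambda,n)\in\Lambda\times\mathbb Z\}$; it is a frame in $L^2(\mathbb R)$ if there are constants $A,B>0$ such that $$A\|f\|_2^2\le\sum_{(\lambda,n)\in\Lambda\times\mathbb Z}\Big|\int_{\mathbb R}f(t)\,\overline{e^{2\pi i\lambda t}g(t-n)}\,dt\Big|^2\le B\|f\|_2^2\qquad\text{for all }f\in L^2(\mathbb R).$$ For $N\in\mathbb N$ let $\mathcal K(N)$ be the class of functions $g(t)=\sum_{k=1}^N\frac{a_k}{t-iw_k}$ with $a_k\in\mathbb C$, $w_k\in\mathbb C\setminus i\mathbb R$, such that $\sum_{k=1}^N a_ke^{2\pi w_kt}\ne0$ for every real $t<0$; such functions belong to $L^2(\mathbb R)$. Let $$D(\Lambda)=\lim_{a\to\infty}\sup_{R\in\mathbb R}\frac{\#(\Lambda\cap[R,R+a])}{a}$$ be the upper density of $\Lambda$. **Theorem 1.** For every $\varepsilon>0$ and every $N\in\mathbb N$ there is a set $\Lambda=\Lambda(\varepsilon,N)\subset\mathbb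 R$, periodic with a positive integer period, with $D(\Lambda)\le1+\varepsilon$, such that $\mathcal G(g,\Lambda\times\mathbb Z)$ is a frame in $L^2(\mathbb R)$ for every $g\in\mathcal K(N)$. -/

import Mathlib

open MeasureTheory Filter Topology
open scoped ENNReal

/-- The Hilbert space `L²(ℝ)` of complex-valued functions. -/
abbrev L2R : Type := Lp ℂ 2 (volume : Measure ℝ)

/-- The time-frequency shift `π_{lam, mu} g (t) = e^{2πi lam t} g(t - mu)` on functions. -/
noncomputable def tfShiftFun (lam mu : ℝ) (g : ℝ → ℂ) : ℝ → ℂ :=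
  fun t => Complex.exp (2 * Real.pi * Complex.I * lam * t) * g (t - mu)

theorem memLp_tfShiftFun (lam mu : ℝ) {g : ℝ → ℂ} (hg : MemLp g 2 (volume : Measure ℝ)) :
    MemLp (tfShiftFun lam mu g) 2 (volume : Measure ℝ) := by
  have h1 : MemLp (fun t => g (t - mu)) 2 (volume : Measure ℝ) :=
    hg.comp_measurePreserving (measurePreserving_sub_right volume mu)
  have hc : Continuous fun t : ℝ => Complex.exp (2 * Real.pi * Complex.I * lam * t) := by
    fun_prop
  refine MemLp.of_le h1 (hc.aestronglyMeasurable.mul h1.1) (Eventually.of_forall fun t => ?_)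
  have h2 : (2 * Real.pi * Complex.I * lam * t : ℂ)
      = ((2 * Real.pi * lam * t : ℝ) : ℂ) * Complex.I := by
    push_cast; ring
  simp only [tfShiftFun, norm_mul]
  rw [h2, Complex.norm_exp_ofReal_mul_I, one_mul]

/-- The time-frequency shift `π_{lam, mu}` on `L²(ℝ)`. -/
noncomputable def tfShift (lam mu : ℝ) (g : L2R) : L2R :=
  (memLp_tfShiftFun lam mu (Lp.memLp g)).toLp (tfShiftFun lam mu g)

/-- The Gabor system `𝒢(g, L) = {π_{lam, mu} g : (lam, mu) ∈ L}`, as a family indexed by `L`. -/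
noncomputable def gaborSystem (g : L2R) (L : Set (ℝ × ℝ)) : L → L2R :=
  fun p => tfShift p.1.1 p.1.2 g

/-- A family of vectors is a frame if it satisfies the two-sided frame inequality with
positive constants; convergence of the sum is part of the claim. -/
def IsFrame {ι H : Type*} [NormedAddCommGroup H] [InnerProductSpace ℂ H] (v : ι → H) : Prop :=
  ∃ A B : ℝ, 0 < A ∧ 0 < B ∧ ∀ f : H,
    Summable (fun i => ‖inner ℂ (v i) f‖ ^ 2) ∧
    A * ‖f‖ ^ 2 ≤ ∑' i, ‖inner ℂ (v i) f‖ ^ 2 ∧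
    ∑' i, ‖inner ℂ (v i) f‖ ^ 2 ≤ B * ‖f‖ ^ 2

/-- `𝒦(N)`: the functions `g(t) = ∑ a_k / (t - i w_k)` on `ℝ`, with `a_k ∈ ℂ` and
`w_k ∈ ℂ \ iℝ`, such that `∑ a_k e^{2π w_k t} ≠ 0` for all real `t < 0`. -/
def simplePoleClass (N : ℕ) : Set (ℝ → ℂ) :=
  {g | ∃ a w : Fin N → ℂ,
    (∀ k, (w k).re ≠ 0) ∧
    (∀ t : ℝ, t < 0 → ∑ k, a k * Complex.exp (2 * Real.pi * w k * t) ≠ 0) ∧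
    ∀ t : ℝ, g t = ∑ k, a k / ((t : ℂ) - Complex.I * w k)}

/-- `D(Lam) = D`, where `D(Lam) = lim_{a → ∞} sup_R #(Lam ∩ [R, R + a]) / a`; existence of the
limit is part of the claim. -/
def HasUpperDensity (Lam : Set ℝ) (D : ℝ≥0∞) : Prop :=
  Tendsto (fun a : ℝ => ⨆ R : ℝ,
    (((Lam ∩ Set.Icc R (R + a)).encard : ℕ∞) : ℝ≥0∞) / ENNReal.ofReal a) atTop (𝓝 D)

/-- A set of reals that is invariant under translation by some positive integer. -/
def IsIntPeriodic (Lam : Set ℝ) : Prop :=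
  ∃ T : ℕ, 0 < T ∧ ∀ x : ℝ, x + T ∈ Lam ↔ x ∈ Lam

/-!
The Fourier transform of `g(t) = ∑ a_k / (t - i w_k)` is, up to the factor `2πi`, the function `h`
(`halfExpSum`) that equals the part with `Re w > 0` of the exponential sum `G(x) = ∑ a_k e^{2πw_k x}`
on `x < 0` and minus the part with `Re w < 0` on `x ≥ 0` (`fourierInv_halfExpSum`). After Plancherel,
periodization and Parseval's identity in the integer time shifts, the frame inequality becomes
`κ ∑_k |c_k|² ≤ ∑_{λ ∈ Λ} |S(λ)|² ≤ B ∑_k |c_k|²`, uniformly for almost all `y ∈ [0, 1]`, where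
`S(λ) = ∑_k c_k h(y + k - λ)` is a fiber of the analysis operator
(`isFrame_gaborSystem_of_fiber_bound`). The upper bound is Young's inequality.

For the lower bound, let `p` (`shiftPoly`) be the polynomial with the distinct roots `e^{-2πw_k}`, of
degree `n ≤ N`. Applied to the unit shift it annihilates every exponential, so it turns `h` into a
function supported in `[0, n)`, and `n + 1` values of `S` at unit distances into a linear form in `n`
consecutive unknowns `c_k` (`sum_shiftPoly_coeff_mul_fiberSum`). The coefficients of this form
(`jumpCoeff`) are analytic in the fractional part of `y - λ`.

* With `ℤ ⊆ Λ` these forms are a banded Toeplitz system whose last coefficient is `G(y - 1)`. It does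
  not vanish for `y < 1`, by the hypothesis on `G`. At the limit point `y = 1` it may, and then the
  coefficient before it is `G(-1) ≠ 0` (`exists_last_jumpCoeff_ne_zero`). So the unknowns are
  determined recursively once `n` consecutive ones are known.
* Such a block is determined by the forms belonging to `λ = jθ`, `j < N`, as soon as the numbers
  `e^{-2πw_kθ}` are distinct: a Vandermonde argument followed by counting zeros of a polynomial
  (`eq_zero_of_sum_jumpCoeff_progression`). Among `N² + 1` steps `θ_i` with irrational ratios one has
  this property, whatever the `w_k` are (`exists_stepSize_injOn`).

Repeating the additional progressions only once in each period `L` costs density `O(1 / L)`, while the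
system on a window of length `L` between two determined blocks is injective for each `y ∈ [0, 1]`
(`eq_zero_of_window`), hence bounded below uniformly in `y` by compactness. Summation over the
windows gives the lower bound (`le_tsum_enorm_fiberSum`).
-/

/-! ### Periodic sets and their density -/

/-- The set `F + Lℤ`. -/
def periodicSet (F : Finset ℝ) (L : ℕ) : Set ℝ := {x | ∃ s ∈ F, ∃ m : ℤ, x = s + m * L}

theorem isIntPeriodic_periodicSet (F : Finset ℝ) {L : ℕ} (hL : 0 < L) :
    IsIntPeriodic (periodicSet F L) := by
  refine ⟨L, hL, fun x => ⟨?_, ?_⟩⟩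
  · rintro ⟨s, hs, m, hm⟩
    exact ⟨s, hs, m - 1, by push_cast; linarith⟩
  · rintro ⟨s, hs, m, hm⟩
    exact ⟨s, hs, m + 1, by push_cast; linarith⟩

theorem countable_periodicSet (F : Finset ℝ) (L : ℕ) : (periodicSet F L).Countable := by
  have : periodicSet F L = ⋃ s ∈ F, Set.range (fun m : ℤ => s + m * L) := by
    ext x; simp [periodicSet, eq_comm]
  rw [this]
  exact F.countable_toSet.biUnion fun s _ => Set.countable_range _

theorem exists_periodicSet_eq_Ico (F : Finset ℝ) {L : ℕ} (hL : 0 < L) :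
    ∃ F' : Finset ℝ, F'.card ≤ F.card ∧ (∀ s ∈ F', s ∈ Set.Ico (0 : ℝ) L) ∧
      periodicSet F' L = periodicSet F L := by
  have hL' : (0 : ℝ) < L := by exact_mod_cast hL
  classical
  have key : ∀ s : ℝ, s = toIcoMod hL' 0 s + (toIcoDiv hL' 0 s : ℤ) * L := by
    intro s
    have := toIcoMod_add_toIcoDiv_zsmul hL' 0 s
    rw [zsmul_eq_mul] at this
    exact this.symm
  refine ⟨F.image (toIcoMod hL' 0), Finset.card_image_le, ?_, ?_⟩
  · intro s hs
    obtain ⟨t, -, rfl⟩ := Finset.mem_image.1 hs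
    simpa using toIcoMod_mem_Ico hL' 0 t
  · ext x
    constructor
    · rintro ⟨s, hs, m, rfl⟩
      obtain ⟨t, ht, rfl⟩ := Finset.mem_image.1 hs
      refine ⟨t, ht, m - toIcoDiv hL' 0 t, ?_⟩
      have := key t
      push_cast
      linarith
    · rintro ⟨s, hs, m, rfl⟩
      refine ⟨_, Finset.mem_image_of_mem _ hs, m + toIcoDiv hL' 0 s, ?_⟩
      have := key s
      push_cast
      linarith

/-- A coset `s + Lℤ` meets `[R, R + a]` in `⌊(R + a - s) / L⌋ - ⌈(R - s) / L⌉ + 1` points. -/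
theorem encard_coset_inter_Icc (s : ℝ) {L : ℕ} (hL : 0 < L) (R a : ℝ) :
    ((Set.range (fun m : ℤ => s + m * L) ∩ Set.Icc R (R + a)).encard : ℕ∞) =
      ((⌊(R + a - s) / L⌋ + 1 - ⌈(R - s) / L⌉).toNat : ℕ) := by
  have hL' : (0 : ℝ) < L := by exact_mod_cast hL
  have hinj : Function.Injective (fun m : ℤ => s + m * L) := by
    intro m m' h
    have h2 : (m : ℝ) * L = m' * L := by simpa using h
    exact_mod_cast mul_right_cancel₀ hL'.ne' h2
  have : Set.range (fun m : ℤ => s + m * L) ∩ Set.Icc R (R + a) =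
      (fun m : ℤ => s + m * L) '' (Finset.Icc ⌈(R - s) / L⌉ ⌊(R + a - s) / L⌋ : Finset ℤ) := by
    ext x
    simp only [Set.mem_inter_iff, Set.mem_range, Set.mem_image, Finset.mem_coe, Finset.mem_Icc,
      Set.mem_Icc, Int.ceil_le, Int.le_floor]
    constructor
    · rintro ⟨⟨m, rfl⟩, h1, h2⟩
      refine ⟨m, ⟨?_, ?_⟩, rfl⟩
      · rw [div_le_iff₀ hL']; linarith
      · rw [le_div_iff₀ hL']; linarith
    · rintro ⟨m, ⟨h1, h2⟩, rfl⟩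
      rw [div_le_iff₀ hL'] at h1
      rw [le_div_iff₀ hL'] at h2
      exact ⟨⟨m, rfl⟩, by linarith, by linarith⟩
  rw [this, hinj.encard_image, Set.encard_coe_eq_coe_finsetCard, Int.card_Icc]

theorem encard_coset_inter_Icc_bounds (s : ℝ) {L : ℕ} (hL : 0 < L) (R : ℝ) {a : ℝ} (ha : 0 < a) :
    ENNReal.ofReal (a / L - 1) ≤
      (((Set.range (fun m : ℤ => s + m * L) ∩ Set.Icc R (R + a)).encard : ℕ∞) : ℝ≥0∞) ∧
    (((Set.range (fun m : ℤ => s + m * L) ∩ Set.Icc R (R + a)).encard : ℕ∞) : ℝ≥0∞) ≤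
      ENNReal.ofReal (a / L + 1) := by
  have hL' : (0 : ℝ) < L := by exact_mod_cast hL
  rw [encard_coset_inter_Icc s hL]
  set z : ℤ := ⌊(R + a - s) / L⌋ + 1 - ⌈(R - s) / L⌉ with hz
  have e : (R + a - s) / L = (R - s) / L + a / L := by ring
  have h1 : a / L - 1 ≤ (z : ℝ) := by
    have := Int.lt_floor_add_one ((R + a - s) / L)
    have := Int.ceil_lt_add_one ((R - s) / L)
    rw [hz]; push_cast; linarith
  have h2 : (z : ℝ) ≤ a / L + 1 := by
    have := Int.floor_le ((R + a - s) / L)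
    have := Int.le_ceil ((R - s) / L)
    rw [hz]; push_cast; linarith
  have h3 : (0 : ℝ) ≤ a / L + 1 := by positivity
  have h4 : ((((z.toNat : ℕ) : ℕ∞) : ℝ≥0∞)) = ENNReal.ofReal ((z.toNat : ℕ) : ℝ) := by
    simp
  have h5 : ((z.toNat : ℕ) : ℝ) = max (z : ℝ) 0 := by
    have : ((z.toNat : ℕ) : ℤ) = max z 0 := Int.toNat_eq_max z
    exact_mod_cast congrArg (fun t : ℤ => (t : ℝ)) this
  rw [h4, h5]
  constructor
  · exact ENNReal.ofReal_le_ofReal (h1.trans (le_max_left _ _))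
  · exact ENNReal.ofReal_le_ofReal (max_le h2 h3)

theorem encard_periodicSet_inter {F : Finset ℝ} {L : ℕ} (hL : 0 < L)
    (hF : ∀ s ∈ F, s ∈ Set.Ico (0 : ℝ) L) (I : Set ℝ) :
    (((periodicSet F L ∩ I).encard : ℕ∞) : ℝ≥0∞) =
      ∑ s ∈ F, (((Set.range (fun m : ℤ => s + m * L) ∩ I).encard : ℕ∞) : ℝ≥0∞) := by
  have hL' : (0 : ℝ) < L := by exact_mod_cast hL
  have hU : periodicSet F L ∩ I = ⋃ s ∈ F, (Set.range (fun m : ℤ => s + m * L) ∩ I) := by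
    ext x; simp [periodicSet, eq_comm]
    tauto
  have hd : (F : Set ℝ).PairwiseDisjoint (fun s => Set.range (fun m : ℤ => s + m * L) ∩ I) := by
    intro s hs t ht hst
    refine Set.disjoint_left.2 ?_
    rintro x ⟨⟨m, rfl⟩, -⟩ ⟨⟨m', h⟩, -⟩
    apply hst
    have h1 := hF s hs
    have h2 := hF t ht
    have h3 : ((m' - m : ℤ) : ℝ) * L = s - t := by push_cast; simp only at h; linarith
    have h4 : m' - m = 0 := by
      have u1 : ((m' - m : ℤ) : ℝ) < 1 := by
        by_contra hc; push Not at hc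
        nlinarith [h1.1, h1.2, h2.1, h2.2]
      have u2 : (-1 : ℝ) < ((m' - m : ℤ) : ℝ) := by
        by_contra hc; push Not at hc
        nlinarith [h1.1, h1.2, h2.1, h2.2]
      have u1' : m' - m < 1 := by exact_mod_cast u1
      have u2' : -1 < m' - m := by exact_mod_cast u2
      omega
    rw [h4] at h3
    simp at h3
    linarith
  rw [hU]
  clear hU hF
  classical
  induction F using Finset.induction_on with
  | empty => simp
  | insert s F hs ih =>
    have hd' := hd
    rw [Finset.coe_insert, Set.pairwiseDisjoint_insert] at hd'
    rw [Finset.sum_insert hs, ← ih hd'.1, Finset.set_biUnion_insert, Set.encard_union_eq]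
    · simp
    · refine Set.disjoint_iUnion₂_right.2 fun t ht => hd'.2 t ht ?_
      rintro rfl; exact hs ht

theorem hasUpperDensity_periodicSet {F : Finset ℝ} {L : ℕ} (hL : 0 < L)
    (hF : ∀ s ∈ F, s ∈ Set.Ico (0 : ℝ) L) :
    HasUpperDensity (periodicSet F L) (ENNReal.ofReal (F.card / L)) := by
  have hL' : (0 : ℝ) < L := by exact_mod_cast hL
  have lim : ∀ c : ℝ, Tendsto (fun a : ℝ => ENNReal.ofReal (F.card / L + c / a)) atTop
      (𝓝 (ENNReal.ofReal (F.card / L))) := by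
    intro c
    have h0 : Tendsto (fun a : ℝ => (F.card / L + c / a : ℝ)) atTop (𝓝 (F.card / L + 0)) :=
      tendsto_const_nhds.add (tendsto_const_nhds.div_atTop tendsto_id)
    rw [add_zero] at h0
    exact ENNReal.tendsto_ofReal h0
  refine tendsto_of_tendsto_of_tendsto_of_le_of_le' (lim (-F.card)) (lim F.card) ?_ ?_
  · filter_upwards [eventually_gt_atTop (0 : ℝ)] with a ha
    refine le_trans ?_ (le_iSup _ (0 : ℝ))
    rw [encard_periodicSet_inter hL hF, ENNReal.le_div_iff_mul_le (by simp [ha]) (by simp),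
      ← ENNReal.ofReal_mul' ha.le]
    have : (F.card / L + -F.card / a : ℝ) * a = F.card * (a / L - 1) := by
      field_simp; ring
    rw [this, ENNReal.ofReal_mul (by positivity), ENNReal.ofReal_natCast]
    rw [← nsmul_eq_mul]
    exact Finset.card_nsmul_le_sum _ _ _ fun s _ => (encard_coset_inter_Icc_bounds s hL 0 ha).1
  · filter_upwards [eventually_gt_atTop (0 : ℝ)] with a ha
    refine iSup_le fun R => ?_
    rw [encard_periodicSet_inter hL hF]
    refine ENNReal.div_le_of_le_mul ?_
    rw [← ENNReal.ofReal_mul' ha.le]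
    have : (F.card / L + F.card / a : ℝ) * a = F.card * (a / L + 1) := by
      field_simp
    rw [this, ENNReal.ofReal_mul (by positivity), ENNReal.ofReal_natCast]
    rw [← nsmul_eq_mul]
    exact Finset.sum_le_card_nsmul _ _ _ fun s _ => (encard_coset_inter_Icc_bounds s hL R ha).2

/-! ### Steps separating exponentials -/

/-- The steps `θ_i = 1 / (2N (√2 + i))`: small enough that `jθ_i ∈ [0, 1)` for `j < 2N`, and with
pairwise irrational ratios. -/
noncomputable def stepSize (N i : ℕ) : ℝ := 1 / (2 * N * (Real.sqrt 2 + i))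

theorem stepSize_nonneg (N i : ℕ) : 0 ≤ stepSize N i := by unfold stepSize; positivity

theorem mul_stepSize_lt_one {N j : ℕ} (hj : j < 2 * N) (i : ℕ) : j * stepSize N i < 1 := by
  have h2 : (1 : ℝ) < Real.sqrt 2 := by
    rw [Real.lt_sqrt] <;> norm_num
  have hN : (0 : ℝ) < N := by
    have : 0 < N := by omega
    exact_mod_cast this
  have hj' : (j : ℝ) < 2 * N := by exact_mod_cast hj
  have hi : (0 : ℝ) ≤ i := by positivity
  rw [stepSize, mul_one_div, div_lt_one (by positivity)]
  nlinarith

theorem eq_of_exp_stepSize_eq {N i i' : ℕ} (hN : 0 < N) (hii : i ≠ i') {w w' : ℂ}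
    (h1 : Complex.exp (-2 * Real.pi * w * stepSize N i) =
      Complex.exp (-2 * Real.pi * w' * stepSize N i))
    (h2 : Complex.exp (-2 * Real.pi * w * stepSize N i') =
      Complex.exp (-2 * Real.pi * w' * stepSize N i')) : w = w' := by
  have hN' : (0 : ℝ) < N := by exact_mod_cast hN
  have hs : (0 : ℝ) < Real.sqrt 2 := by positivity
  have aux : ∀ i : ℕ, Complex.exp (-2 * Real.pi * w * stepSize N i) =
      Complex.exp (-2 * Real.pi * w' * stepSize N i) →
      ∃ m : ℤ, w - w' = ((m * (2 * N * (Real.sqrt 2 + i)) : ℝ) : ℂ) * Complex.I := by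
    intro i h
    obtain ⟨m, hm⟩ := Complex.exp_eq_exp_iff_exists_int.1 h
    refine ⟨-m, ?_⟩
    have hne : ((2 * N * (Real.sqrt 2 + i) : ℝ) : ℂ) ≠ 0 := by
      rw [Complex.ofReal_ne_zero]; positivity
    have hpi : (Real.pi : ℂ) ≠ 0 := by exact_mod_cast Real.pi_ne_zero
    have hst : (stepSize N i : ℂ) = 1 / ((2 * N * (Real.sqrt 2 + i) : ℝ) : ℂ) := by
      rw [stepSize]; push_cast; rfl
    rw [hst] at hm
    have h3 : (2 * Real.pi : ℂ) * ((w - w') + m * ((2 * N * (Real.sqrt 2 + i) : ℝ) : ℂ) *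
        Complex.I) = 0 := by
      field_simp at hm
      linear_combination (-2 * Real.pi : ℂ) * hm
    have h4 := (mul_eq_zero.1 h3).resolve_left (by simp [hpi])
    push_cast at h4 ⊢
    linear_combination h4
  obtain ⟨a, ha⟩ := aux i h1
  obtain ⟨b, hb⟩ := aux i' h2
  have hab : (a * (2 * N * (Real.sqrt 2 + i)) : ℝ) = b * (2 * N * (Real.sqrt 2 + i')) := by
    have := mul_right_cancel₀ Complex.I_ne_zero (ha.symm.trans hb)
    exact_mod_cast this
  have hab2 : (a : ℝ) * (Real.sqrt 2 + i) = b * (Real.sqrt 2 + i') := by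
    have : (2 * N : ℝ) * (a * (Real.sqrt 2 + i)) = (2 * N) * (b * (Real.sqrt 2 + i')) := by
      linarith
    exact mul_left_cancel₀ (by positivity) this
  have hirr : Real.sqrt 2 * ((a - b : ℤ) : ℝ) = ((b * i' - a * i : ℤ) : ℝ) := by
    push_cast; linarith
  -- `√2 (a - b)` is an integer
  have hab3 : a - b = 0 := by
    by_contra hne
    exact (irrational_sqrt_two.mul_intCast hne).ne_int _ hirr
  have hab4 : a = b := by omega
  subst hab4
  have hz : (a : ℝ) * ((i : ℝ) - i') = 0 := by linarith
  have hii' : ((i : ℝ) - i') ≠ 0 := by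
    rw [sub_ne_zero]; exact_mod_cast hii
  have ha0 := (mul_eq_zero.1 hz).resolve_right hii'
  rw [ha0] at ha
  simp at ha
  exact sub_eq_zero.1 ha

/-- Two steps with irrational ratio cannot both make the same pair of exponentials coincide, so
by the pigeonhole principle one of `N² + 1` steps separates any `N` exponents. -/
theorem exists_stepSize_injOn {N : ℕ} (hN : 0 < N) (W : Finset ℂ) (hW : W.card ≤ N) :
    ∃ i ∈ Finset.range (N ^ 2 + 1),
      Set.InjOn (fun w : ℂ => Complex.exp (-2 * Real.pi * w * stepSize N i)) W := by
  classical
  by_contra hcon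
  push Not at hcon
  have h : ∀ i ∈ Finset.range (N ^ 2 + 1), ∃ q : ℂ × ℂ, q ∈ W.offDiag ∧
      Complex.exp (-2 * Real.pi * q.1 * stepSize N i) =
      Complex.exp (-2 * Real.pi * q.2 * stepSize N i) := by
    intro i hi
    have := hcon i hi
    simp only [Set.InjOn] at this
    push Not at this
    obtain ⟨w, hw, w', hw', he, hne⟩ := this
    exact ⟨(w, w'), Finset.mem_offDiag.2 ⟨hw, hw', hne⟩, he⟩
  choose! q hq1 hq2 using h
  have hcard : W.offDiag.card < (Finset.range (N ^ 2 + 1)).card := by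
    rw [Finset.offDiag_card, Finset.card_range]
    have : W.card * W.card ≤ N * N := Nat.mul_le_mul hW hW
    rw [sq]; omega
  obtain ⟨i, hi, i', hi', hne, he⟩ :=
    Finset.exists_ne_map_eq_of_card_lt_of_maps_to hcard hq1
  have h1 := hq2 i hi
  have h2 := hq2 i' hi'
  rw [← he] at h2
  exact (Finset.mem_offDiag.1 (hq1 i hi)).2.2 (eq_of_exp_stepSize_eq hN hne h1 h2)

/-! ### Exponential sums and the shift polynomial -/

section

open Polynomial

/-- The exponential sum `G(x) = ∑_{w ∈ W} A(w) e^{2πwx}`. -/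
noncomputable def expSum (W : Finset ℂ) (A : ℂ → ℂ) (x : ℝ) : ℂ :=
  ∑ w ∈ W, A w * Complex.exp (2 * Real.pi * w * x)

/-- The integrable function that keeps the growing exponentials of `expSum W A` on `x < 0` and
minus the others on `x ≥ 0`. -/
noncomputable def halfExpSum (W : Finset ℂ) (A : ℂ → ℂ) (x : ℝ) : ℂ :=
  if x < 0 then expSum (W.filter fun w => 0 < w.re) A x
  else -expSum (W.filter fun w => ¬ 0 < w.re) A x

/-- The polynomial with simple roots `e^{-2πw}`, `w ∈ W`; it annihilates the unit backward shift on
exponential sums with frequencies in `W`. -/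
noncomputable def shiftPoly (W : Finset ℂ) : ℂ[X] :=
  ∏ u ∈ W.image (fun w : ℂ => Complex.exp (-2 * Real.pi * w)), (X - C u)

/-- The polynomial `shiftPoly W`, evaluated at the unit backward shift, sends `halfExpSum W A` to
the function taking the value `jumpCoeff W A i s` at `s + i`, for `s ∈ [0, 1)` and `i ∈ ℤ`. -/
noncomputable def jumpCoeff (W : Finset ℂ) (A : ℂ → ℂ) (i : ℤ) (s : ℝ) : ℂ :=
  ∑ j ∈ Finset.range ((shiftPoly W).natDegree + 1),
    if i < j then (shiftPoly W).coeff j * expSum W A (s + i - j) else 0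

theorem shiftPoly_monic (W : Finset ℂ) : (shiftPoly W).Monic :=
  monic_prod_of_monic _ _ fun u _ => monic_X_sub_C u

theorem natDegree_shiftPoly (W : Finset ℂ) : (shiftPoly W).natDegree =
    (W.image (fun w : ℂ => Complex.exp (-2 * Real.pi * w))).card := by
  rw [shiftPoly, natDegree_prod_of_monic _ _ fun u _ => monic_X_sub_C u]
  simp

theorem natDegree_shiftPoly_le (W : Finset ℂ) : (shiftPoly W).natDegree ≤ W.card := by
  rw [natDegree_shiftPoly]; exact Finset.card_image_le

theorem natDegree_shiftPoly_pos {W : Finset ℂ} (hW : W.Nonempty) :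
    0 < (shiftPoly W).natDegree := by
  rw [natDegree_shiftPoly]; exact (hW.image _).card_pos

theorem eval_shiftPoly {W : Finset ℂ} {w : ℂ} (hw : w ∈ W) :
    (shiftPoly W).eval (Complex.exp (-2 * Real.pi * w)) = 0 := by
  rw [shiftPoly, eval_prod]
  exact Finset.prod_eq_zero (Finset.mem_image_of_mem _ hw) (by simp)

theorem continuous_expSum (W : Finset ℂ) (A : ℂ → ℂ) : Continuous (expSum W A) := by
  unfold expSum; fun_prop

theorem continuous_jumpCoeff (W : Finset ℂ) (A : ℂ → ℂ) (i : ℤ) :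
    Continuous (jumpCoeff W A i) := by
  unfold jumpCoeff
  refine continuous_finsetSum _ fun j _ => ?_
  split_ifs
  · exact continuous_const.mul ((continuous_expSum W A).comp (by fun_prop))
  · exact continuous_const

theorem measurable_halfExpSum (W : Finset ℂ) (A : ℂ → ℂ) : Measurable (halfExpSum W A) :=
  Measurable.ite measurableSet_Iio (continuous_expSum _ _).measurable
    (continuous_expSum _ _).measurable.neg

theorem exp_shift (w : ℂ) (x : ℝ) (j : ℕ) :
    Complex.exp (2 * Real.pi * w * ((x - j : ℝ) : ℂ)) =
      Complex.exp (2 * Real.pi * w * x) * Complex.exp (-2 * Real.pi * w) ^ j := by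
  rw [← Complex.exp_nat_mul, ← Complex.exp_add]
  congr 1; push_cast; ring

theorem sum_shiftPoly_coeff_mul_expSum {W V : Finset ℂ} (hV : V ⊆ W) (A : ℂ → ℂ) (x : ℝ) :
    ∑ j ∈ Finset.range ((shiftPoly W).natDegree + 1),
      (shiftPoly W).coeff j * expSum V A (x - j) = 0 := by
  simp only [expSum, Finset.mul_sum]
  rw [Finset.sum_comm]
  refine Finset.sum_eq_zero fun w hw => ?_
  have h := eval_shiftPoly (hV hw)
  rw [eval_eq_sum_range] at h
  have : ∀ j ∈ Finset.range ((shiftPoly W).natDegree + 1), (shiftPoly W).coeff j *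
      (A w * Complex.exp (2 * Real.pi * w * ((x - j : ℝ) : ℂ))) =
      (A w * Complex.exp (2 * Real.pi * w * x)) *
        ((shiftPoly W).coeff j * Complex.exp (-2 * Real.pi * w) ^ j) := by
    intro j _
    rw [exp_shift]; ring
  rw [Finset.sum_congr rfl this, ← Finset.mul_sum, h, mul_zero]

theorem sum_shiftPoly_coeff_mul_halfExpSum (W : Finset ℂ) (A : ℂ → ℂ) {s : ℝ}
    (hs : s ∈ Set.Ico (0 : ℝ) 1) (i : ℤ) :
    ∑ j ∈ Finset.range ((shiftPoly W).natDegree + 1),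
      (shiftPoly W).coeff j * halfExpSum W A (s + i - j) = jumpCoeff W A i s := by
  have hsplit : ∀ x : ℝ, halfExpSum W A x = (if x < 0 then expSum W A x else 0) -
      expSum (W.filter fun w => ¬ 0 < w.re) A x := by
    intro x
    have : expSum W A x = expSum (W.filter fun w => 0 < w.re) A x +
        expSum (W.filter fun w => ¬ 0 < w.re) A x := by
      simp only [expSum]
      exact (Finset.sum_filter_add_sum_filter_not _ _ _).symm
    unfold halfExpSum
    split_ifs
    · rw [this]; ring
    · ring
  simp only [hsplit, mul_sub, Finset.sum_sub_distrib]
  rw [sum_shiftPoly_coeff_mul_expSum (Finset.filter_subset _ _), sub_zero, jumpCoeff]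
  refine Finset.sum_congr rfl fun j _ => ?_
  have : (s + i - j < 0) ↔ i < (j : ℤ) := by
    constructor
    · intro h
      have : (i : ℝ) < ((j : ℤ) : ℝ) := by push_cast; linarith [hs.1]
      exact_mod_cast this
    · intro h
      have : (i : ℝ) + 1 ≤ ((j : ℤ) : ℝ) := by exact_mod_cast h
      push_cast at this
      linarith [hs.2]
  simp only [this]
  split_ifs <;> simp

theorem jumpCoeff_of_neg (W : Finset ℂ) (A : ℂ → ℂ) {i : ℤ} (hi : i < 0) (s : ℝ) :
    jumpCoeff W A i s = 0 := by
  rw [← sum_shiftPoly_coeff_mul_expSum (W := W) subset_rfl A (s + i), jumpCoeff]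
  refine Finset.sum_congr rfl fun j _ => ?_
  rw [if_pos (by omega)]

theorem jumpCoeff_of_natDegree_le (W : Finset ℂ) (A : ℂ → ℂ) {i : ℤ}
    (hi : ((shiftPoly W).natDegree : ℤ) ≤ i) (s : ℝ) : jumpCoeff W A i s = 0 := by
  rw [jumpCoeff]
  refine Finset.sum_eq_zero fun j hj => ?_
  rw [Finset.mem_range] at hj
  rw [if_neg (by omega)]

theorem jumpCoeff_natDegree_sub_one (W : Finset ℂ) (A : ℂ → ℂ) (s : ℝ) :
    jumpCoeff W A ((shiftPoly W).natDegree - 1) s = expSum W A (s - 1) := by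
  rw [jumpCoeff, Finset.sum_range_succ, Finset.sum_eq_zero, zero_add, if_pos (by omega),
    (shiftPoly_monic W).coeff_natDegree, one_mul]
  · congr 1; push_cast; ring
  · intro j hj
    rw [Finset.mem_range] at hj
    rw [if_neg (by omega)]

theorem jumpCoeff_one (W : Finset ℂ) (A : ℂ → ℂ) (h0 : expSum W A 0 = 0) (i : ℤ) :
    jumpCoeff W A i 1 = jumpCoeff W A (i + 1) 0 := by
  rw [jumpCoeff, jumpCoeff]
  refine Finset.sum_congr rfl fun j _ => ?_
  rcases lt_trichotomy (i + 1) (j : ℤ) with h | h | h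
  · rw [if_pos (by omega), if_pos h]
    congr 2; push_cast; ring
  · rw [if_pos (by omega), if_neg (by omega)]
    have : (1 + (i : ℝ) - j) = 0 := by
      have : ((i : ℝ) + 1) = j := by exact_mod_cast congrArg (fun t : ℤ => (t : ℝ)) h
      linarith
    rw [this, h0, mul_zero]
  · rw [if_neg (by omega), if_neg (by omega)]

/-- At every point of `[0, 1]` the vector of jump coefficients has a last nonzero entry. At the
right end point `G(0)` may vanish; then the entry before it is `G(-1)`. -/
theorem exists_last_jumpCoeff_ne_zero {W : Finset ℂ} (hW : W.Nonempty) {A : ℂ → ℂ}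
    (hG : ∀ t : ℝ, t < 0 → expSum W A t ≠ 0) {y : ℝ} (hy : y ∈ Set.Icc (0 : ℝ) 1) :
    ∃ q : ℕ, q < (shiftPoly W).natDegree ∧ jumpCoeff W A q y ≠ 0 ∧
      ∀ i : ℤ, (q : ℤ) < i → jumpCoeff W A i y = 0 := by
  have hn := natDegree_shiftPoly_pos hW
  have lead : ∀ y : ℝ, jumpCoeff W A (((shiftPoly W).natDegree - 1 : ℕ) : ℤ) y =
      expSum W A (y - 1) := by
    intro y
    rw [← jumpCoeff_natDegree_sub_one W]
    congr 1; omega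
  by_cases h : expSum W A (y - 1) = 0
  · -- `G(y - 1) = 0` forces `y = 1` and `G(0) = 0`
    have hy1 : y = 1 := by
      by_contra hne
      exact hG (y - 1) (by linarith [lt_of_le_of_ne hy.2 hne]) h
    subst hy1
    rw [sub_self] at h
    have h2 : 2 ≤ (shiftPoly W).natDegree := by
      -- for `n = 1` the recurrence would give `G(-1) = 0` as well
      by_contra hlt
      have h1 : (shiftPoly W).natDegree = 1 := by omega
      have hrec := sum_shiftPoly_coeff_mul_expSum (W := W) subset_rfl A 0
      have hm := (shiftPoly_monic W).coeff_natDegree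
      rw [h1] at hrec hm
      rw [Finset.sum_range_succ, Finset.sum_range_one, hm] at hrec
      simp only [Nat.cast_zero, sub_zero, h, Nat.cast_one, zero_sub, mul_zero, zero_add,
        one_mul] at hrec
      exact hG (-1) (by norm_num) hrec
    refine ⟨(shiftPoly W).natDegree - 2, by omega, ?_, ?_⟩
    · rw [jumpCoeff_one W A h]
      have : (((shiftPoly W).natDegree - 2 : ℕ) : ℤ) + 1 =
          (((shiftPoly W).natDegree - 1 : ℕ) : ℤ) := by omega
      rw [this, lead]
      exact hG _ (by norm_num)
    · intro i hi
      rw [jumpCoeff_one W A h]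
      exact jumpCoeff_of_natDegree_le W A (by omega) 0
  · refine ⟨(shiftPoly W).natDegree - 1, by omega, ?_, ?_⟩
    · rwa [lead]
    · intro i hi
      exact jumpCoeff_of_natDegree_le W A (by omega) y

/-- A Vandermonde argument: an exponential sum with at most `N` frequencies separated by the step
`θ` vanishes on `N` consecutive points of an arithmetic progression of step `θ` only if all its
coefficients do. -/
theorem eq_zero_of_expSum_progression {W : Finset ℂ} {N : ℕ} (hW : W.card ≤ N) {θ : ℝ}
    (hθ : Set.InjOn (fun w : ℂ => Complex.exp (-2 * Real.pi * w * θ)) W) {b : ℂ → ℂ} {x : ℝ}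
    (h : ∀ j < N, expSum W b (x - j * θ) = 0) : ∀ w ∈ W, b w = 0 := by
  intro w hw
  set z : ℂ → ℂ := fun w => Complex.exp (-2 * Real.pi * w * θ) with hz
  set e : ℂ → ℂ := fun w => b w * Complex.exp (2 * Real.pi * w * x) with he
  have hpow : ∀ j < N, ∑ v ∈ W, e v * z v ^ j = 0 := by
    intro j hj
    rw [← h j hj, expSum]
    refine Finset.sum_congr rfl fun v _ => ?_
    rw [hz, he]
    simp only
    rw [← Complex.exp_nat_mul, mul_assoc, ← Complex.exp_add]
    congr 2; push_cast; ring
  have hpoly : ∀ q : ℂ[X], q.natDegree < N → ∑ v ∈ W, e v * q.eval (z v) = 0 := by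
    intro q hq
    simp only [eval_eq_sum_range, Finset.mul_sum]
    rw [Finset.sum_comm]
    refine Finset.sum_eq_zero fun j hj => ?_
    rw [Finset.mem_range] at hj
    have := hpow j (by omega)
    have h2 : ∀ v ∈ W, e v * (q.coeff j * z v ^ j) = q.coeff j * (e v * z v ^ j) :=
      fun v _ => by ring
    rw [Finset.sum_congr rfl h2, ← Finset.mul_sum, this, mul_zero]
  -- a polynomial that vanishes at all nodes except the one of `w`
  have hq := hpoly (∏ v ∈ W.erase w, (X - C (z v))) (by
    rw [natDegree_prod_of_monic _ _ fun v _ => monic_X_sub_C _]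
    simp only [natDegree_X_sub_C, Finset.sum_const, smul_eq_mul, mul_one]
    have := Finset.card_erase_lt_of_mem hw
    omega)
  rw [Finset.sum_eq_single w] at hq
  · rw [eval_prod] at hq
    have hne : ∏ v ∈ W.erase w, (X - C (z v)).eval (z w) ≠ 0 := by
      refine Finset.prod_ne_zero_iff.2 fun v hv => ?_
      rw [Finset.mem_erase] at hv
      simp only [eval_sub, eval_X, eval_C]
      exact sub_ne_zero.2 fun h => hv.1 (hθ hv.2 hw h.symm)
    exact (mul_eq_zero.1 ((mul_eq_zero.1 hq).resolve_right hne)).resolve_right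
      (Complex.exp_ne_zero _)
  · intro v hv hvw
    rw [eval_prod, Finset.prod_eq_zero (Finset.mem_erase.2 ⟨hvw, hv⟩) (by simp), mul_zero]
  · intro hn; exact absurd hw hn

/-- If `p` is monic of degree `n`, a combination of the tails `∑_{j > i} p_j u^{j-i}`, `i < n`,
that vanishes at `n` distinct nonzero points is trivial: it is a polynomial of degree at most `n`
that also vanishes at `0`. -/
theorem eq_zero_of_sum_tails {p : ℂ[X]} (hp : p.Monic) {U : Finset ℂ} (hU : U.card = p.natDegree)
    (h0 : (0 : ℂ) ∉ U) {c : ℕ → ℂ}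
    (h : ∀ u ∈ U, ∑ i ∈ Finset.range p.natDegree, c i * ∑ j ∈ Finset.range (p.natDegree + 1),
      (if i < j then p.coeff j * u ^ (j - i) else 0) = 0) :
    ∀ i < p.natDegree, c i = 0 := by
  set n := p.natDegree with hn
  set B : ℂ[X] := ∑ i ∈ Finset.range n, C (c i) * ∑ j ∈ Finset.range (n + 1),
      (if i < j then C (p.coeff j) * X ^ (j - i) else 0) with hB
  have heval : ∀ u, B.eval u = ∑ i ∈ Finset.range n, c i * ∑ j ∈ Finset.range (n + 1),
      (if i < j then p.coeff j * u ^ (j - i) else 0) := by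
    intro u
    simp only [hB, eval_finsetSum, eval_mul, eval_C]
    refine Finset.sum_congr rfl fun i _ => ?_
    congr 1
    refine Finset.sum_congr rfl fun j _ => ?_
    split_ifs <;> simp
  have hdeg : B.natDegree ≤ n := by
    refine natDegree_sum_le_of_forall_le _ _ fun i _ => ?_
    refine natDegree_C_mul_le _ _ |>.trans ?_
    refine natDegree_sum_le_of_forall_le _ _ fun j hj => ?_
    rw [Finset.mem_range] at hj
    split_ifs
    · exact (natDegree_C_mul_X_pow_le _ _).trans (by omega)
    · simp
  have hB0 : B = 0 := by
    refine eq_zero_of_natDegree_lt_card_of_eval_eq_zero' B (insert 0 U) ?_ ?_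
    · intro u hu
      rw [heval]
      rcases Finset.mem_insert.1 hu with rfl | hu
      · refine Finset.sum_eq_zero fun i _ => ?_
        rw [Finset.sum_eq_zero, mul_zero]
        intro j _
        split_ifs with hij
        · rw [zero_pow (by omega), mul_zero]
        · rfl
      · exact h u hu
    · rw [Finset.card_insert_of_notMem h0, hU]; omega
  intro i
  induction i using Nat.strong_induction_on with
  | _ i ih =>
    intro hi
    -- the coefficient of `X ^ (n - i)` only involves `c 0, …, c i`
    have hco : B.coeff (n - i) = 0 := by rw [hB0, coeff_zero]
    rw [hB, finsetSum_coeff, Finset.sum_eq_single i] at hco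
    · rw [coeff_C_mul, finsetSum_coeff, Finset.sum_eq_single n] at hco
      · rw [if_pos hi, coeff_C_mul, coeff_X_pow, if_pos rfl, mul_one, hn, hp.coeff_natDegree,
          mul_one] at hco
        exact hco
      · intro j hj hjn
        rw [Finset.mem_range] at hj
        split_ifs with hij
        · rw [coeff_C_mul, coeff_X_pow, if_neg (by omega), mul_zero]
        · simp
      · intro hh; simp at hh
    · intro i' hi' hne
      rw [Finset.mem_range] at hi'
      rw [coeff_C_mul]
      rcases lt_or_gt_of_ne hne with hlt | hgt
      · rw [ih i' hlt hi', zero_mul]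
      · rw [finsetSum_coeff, Finset.sum_eq_zero, mul_zero]
        intro j hj
        rw [Finset.mem_range] at hj
        split_ifs with hij
        · rw [coeff_C_mul, coeff_X_pow, if_neg (by omega), mul_zero]
        · simp
    · intro hh; exact absurd (Finset.mem_range.2 hi) hh

/-- The values of the jump coefficients along `N` consecutive points of a progression with
separating step determine a block of coefficients. -/
theorem eq_zero_of_sum_jumpCoeff_progression {W : Finset ℂ} {N : ℕ} (hW : W.card ≤ N)
    {A : ℂ → ℂ} (hA : ∀ w ∈ W, A w ≠ 0) {θ : ℝ}
    (hθ : Set.InjOn (fun w : ℂ => Complex.exp (-2 * Real.pi * w * θ)) W) {c : ℕ → ℂ} {x : ℝ}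
    (h : ∀ j < N, ∑ i ∈ Finset.range (shiftPoly W).natDegree,
      c i * jumpCoeff W A i (x - j * θ) = 0) :
    ∀ i < (shiftPoly W).natDegree, c i = 0 := by
  refine eq_zero_of_sum_tails (shiftPoly_monic W) (natDegree_shiftPoly W).symm ?_ ?_
  · intro h0
    obtain ⟨w, -, hw⟩ := Finset.mem_image.1 h0
    exact Complex.exp_ne_zero _ hw
  · intro u hu
    obtain ⟨w, hw, rfl⟩ := Finset.mem_image.1 hu
    have key := eq_zero_of_expSum_progression hW hθ (x := x)
      (b := fun w => A w * ∑ i ∈ Finset.range (shiftPoly W).natDegree,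
        c i * ∑ j ∈ Finset.range ((shiftPoly W).natDegree + 1),
          (if i < j then (shiftPoly W).coeff j *
            Complex.exp (-2 * Real.pi * w) ^ (j - i) else 0)) ?_ w hw
    · exact (mul_eq_zero.1 key).resolve_left (hA w hw)
    · intro j hj
      refine Eq.trans ?_ (h j hj)
      simp only [jumpCoeff, expSum, Finset.mul_sum, Finset.sum_mul]
      rw [Finset.sum_comm]
      refine Finset.sum_congr rfl fun i _ => ?_
      rw [Finset.sum_comm]
      refine Finset.sum_congr rfl fun l _ => ?_
      by_cases hil : i < l
      · rw [if_pos (by omega), Finset.mul_sum]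
        refine Finset.sum_congr rfl fun v _ => ?_
        rw [if_pos hil]
        have e1 : (x - j * θ + ((i : ℤ) : ℝ) - l) = (x - j * θ) - ((l - i : ℕ) : ℝ) := by
          rw [Nat.cast_sub hil.le]; push_cast; ring
        rw [e1, exp_shift]
        ring
      · rw [if_neg (by omega), mul_zero]
        exact Finset.sum_eq_zero fun v _ => by rw [if_neg hil]; ring

/-- Forward recursion: if the jump coefficients at `y` have last nonzero entry at `q`, the
equations starting at `m = 0, 1, …, L - 1` propagate the vanishing of the first `q` unknowns. -/
theorem eq_zero_of_recursion {d : ℤ → ℂ} {n q L : ℕ} (hq : d q ≠ 0)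
    (hd : ∀ i : ℤ, (q : ℤ) < i → d i = 0) (hqn : q < n) {c : ℕ → ℂ}
    (h0 : ∀ i < q, c i = 0)
    (h : ∀ m < L, ∑ i ∈ Finset.range n, c (m + i) * d i = 0) : ∀ i < L + q, c i = 0 := by
  intro i
  induction i using Nat.strong_induction_on with
  | _ i ih =>
    intro hi
    by_cases hiq : i < q
    · exact h0 i hiq
    · have := h (i - q) (by omega)
      rw [Finset.sum_eq_single q] at this
      · rw [Nat.sub_add_cancel (by omega)] at this
        exact (mul_eq_zero.1 this).resolve_right hq
      · intro l hl hlq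
        rcases lt_or_gt_of_ne hlq with h1 | h1
        · rw [ih (i - q + l) (by omega) (by omega), zero_mul]
        · rw [hd l (by exact_mod_cast h1), mul_zero]
      · intro hh; exact absurd (Finset.mem_range.2 hqn) hh

/-- The system on a window of `L + n` unknowns is injective: the progressions determine the first
and the last `n` of them and the recursion those in between. The block at the right end is needed
at `y = 1`, where the recursion may stop one step early. -/
theorem eq_zero_of_window {W : Finset ℂ} (hWne : W.Nonempty) {N : ℕ} (hW : W.card ≤ N)
    {A : ℂ → ℂ} (hA : ∀ w ∈ W, A w ≠ 0) (hG : ∀ t : ℝ, t < 0 → expSum W A t ≠ 0) {θ : ℝ}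
    (hθ : Set.InjOn (fun w : ℂ => Complex.exp (-2 * Real.pi * w * θ)) W) {L : ℕ} {c : ℕ → ℂ}
    {x y : ℝ} (hy : y ∈ Set.Icc (0 : ℝ) 1)
    (h1 : ∀ m < L, ∑ i ∈ Finset.range (shiftPoly W).natDegree,
      c (m + i) * jumpCoeff W A i y = 0)
    (h2 : ∀ j < N, ∑ i ∈ Finset.range (shiftPoly W).natDegree,
      c i * jumpCoeff W A i (x - j * θ) = 0)
    (h3 : ∀ j < N, ∑ i ∈ Finset.range (shiftPoly W).natDegree,
      c (L + i) * jumpCoeff W A i (x - j * θ) = 0) :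
    ∀ i < L + (shiftPoly W).natDegree, c i = 0 := by
  obtain ⟨q, hqn, hq, hd⟩ := exists_last_jumpCoeff_ne_zero hWne hG hy
  have hl := eq_zero_of_sum_jumpCoeff_progression hW hA hθ h2
  have hr := eq_zero_of_sum_jumpCoeff_progression hW hA hθ (c := fun i => c (L + i)) h3
  have hm := eq_zero_of_recursion (d := fun i => jumpCoeff W A i y) hq hd hqn
    (fun i hi => hl i (by omega)) h1
  intro i hi
  by_cases hiL : i < L
  · exact hm i (by omega)
  · have := hr (i - L) (by omega)
    rwa [Nat.add_sub_cancel' (by omega)] at this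

end

/-! ### Uniform lower bounds on windows -/

/-- Compactness: a family of linear systems with continuous coefficients that is injective at
every point of a compact set is uniformly bounded below on it. -/
theorem exists_pos_forall_mul_sum_sq_le {ι μ X : Type*} [Fintype ι] [TopologicalSpace X]
    (E : Finset μ) {a : μ → ι → X → ℂ} (ha : ∀ e i, Continuous (a e i)) {K : Set X}
    (hK : IsCompact K)
    (hinj : ∀ y ∈ K, ∀ c : ι → ℂ, (∀ e ∈ E, ∑ i, c i * a e i y = 0) → c = 0) :
    ∃ κ : ℝ, 0 < κ ∧ ∀ y ∈ K, ∀ c : ι → ℂ,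
      κ * ∑ i, ‖c i‖ ^ 2 ≤ ∑ e ∈ E, ‖∑ i, c i * a e i y‖ ^ 2 := by
  set S : Set (ι → ℂ) := {c | ∑ i, ‖c i‖ ^ 2 = 1} with hS
  have hSc : IsCompact S := by
    refine Metric.isCompact_of_isClosed_isBounded ?_ ?_
    · exact isClosed_eq (by fun_prop) continuous_const
    · refine isBounded_iff_forall_norm_le.2 ⟨1, fun c hc => ?_⟩
      refine (pi_norm_le_iff_of_nonneg zero_le_one).2 fun i => ?_
      have h1 : ‖c i‖ ^ 2 ≤ ∑ i, ‖c i‖ ^ 2 :=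
        Finset.single_le_sum (f := fun i => ‖c i‖ ^ 2) (fun i _ => by positivity)
          (Finset.mem_univ i)
      rw [hc.out] at h1
      exact (sq_le_one_iff₀ (norm_nonneg _)).1 h1
  set Q : X × (ι → ℂ) → ℝ := fun z => ∑ e ∈ E, ‖∑ i, z.2 i * a e i z.1‖ ^ 2 with hQ
  have hQc : Continuous Q := by
    refine continuous_finsetSum _ fun e _ => (Continuous.norm ?_).pow 2
    exact continuous_finsetSum _ fun i _ =>
      ((continuous_apply i).comp continuous_snd).mul ((ha e i).comp continuous_fst)
  have hpos : ∀ z ∈ K ×ˢ S, 0 < Q z := by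
    rintro ⟨y, c⟩ ⟨hy, hc⟩
    by_contra hle
    have h0 : Q (y, c) = 0 := le_antisymm (not_lt.1 hle) (Finset.sum_nonneg fun _ _ => by positivity)
    have h1 := (Finset.sum_eq_zero_iff_of_nonneg (fun _ _ => by positivity)).1 h0
    have h2 := hinj y hy c fun e he => by simpa using h1 e he
    rw [hS, Set.mem_ofPred_eq] at hc
    simp only at hc
    rw [h2] at hc
    simp at hc
  obtain ⟨κ, hκ, hle⟩ := (hK.prod hSc).exists_forall_le' hQc.continuousOn hpos
  refine ⟨κ, hκ, fun y hy c => ?_⟩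
  set r : ℝ := ∑ i, ‖c i‖ ^ 2 with hr
  have hr0 : 0 ≤ r := Finset.sum_nonneg fun i _ => by positivity
  rcases hr0.eq_or_lt with h0 | h0
  · rw [← h0, mul_zero]
    exact Finset.sum_nonneg fun _ _ => by positivity
  · set t : ℂ := (((Real.sqrt r)⁻¹ : ℝ) : ℂ) with ht
    have htn : ‖t‖ ^ 2 = r⁻¹ := by
      rw [ht, Complex.norm_real, Real.norm_eq_abs, sq_abs, inv_pow, Real.sq_sqrt h0.le]
    have hmem : (y, fun i => t * c i) ∈ K ×ˢ S := by
      refine ⟨hy, ?_⟩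
      simp only [hS, Set.mem_ofPred_eq, norm_mul, mul_pow, htn, ← Finset.mul_sum]
      exact inv_mul_cancel₀ h0.ne'
    have h1 := hle _ hmem
    simp only [hQ, mul_assoc, ← Finset.mul_sum, norm_mul, mul_pow, htn] at h1
    have h2 := mul_le_mul_of_nonneg_right h1 h0.le
    rwa [mul_right_comm, inv_mul_cancel₀ h0.ne', one_mul] at h2

/-- The equations used on a window: `(m, τ)` stands for the equation with jump coefficients at
`y + τ` whose first unknown is the `m`-th one. The critical equations are `(m, 0)`; the two blocks
of additional ones sit at both ends of the window. -/
noncomputable def windowEquations (L N : ℕ) (θ σ : ℝ) : Finset (ℕ × ℝ) :=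
  (Finset.range L).image (fun m => (m, 0)) ∪
    ((Finset.range N).image (fun j : ℕ => (0, σ - j * θ)) ∪
      (Finset.range N).image (fun j : ℕ => (L, σ - j * θ)))

theorem sum_fin_mul_jumpCoeff (W : Finset ℂ) (A : ℂ → ℂ) {L m : ℕ} (hm : m ≤ L) (x : ℝ)
    (c : ℕ → ℂ) :
    ∑ t ∈ Finset.range (L + (shiftPoly W).natDegree), c t * jumpCoeff W A ((t : ℤ) - m) x =
      ∑ i ∈ Finset.range (shiftPoly W).natDegree, c (m + i) * jumpCoeff W A i x := by
  have h := Finset.sum_Ico_eq_sum_range (fun t => c t * jumpCoeff W A ((t : ℤ) - m) x) m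
    (m + (shiftPoly W).natDegree)
  rw [Nat.add_sub_cancel_left] at h
  have h2 : ∀ i : ℕ, ((m + i : ℕ) : ℤ) - m = i := fun i => by omega
  simp only [h2] at h
  rw [← h]
  symm
  refine Finset.sum_subset ?_ ?_
  · intro t ht
    rw [Finset.mem_Ico] at ht
    rw [Finset.mem_range]; omega
  · intro t _ ht
    rw [Finset.mem_Ico] at ht
    by_cases htm : t < m
    · rw [jumpCoeff_of_neg W A (by omega), mul_zero]
    · rw [jumpCoeff_of_natDegree_le W A (by omega), mul_zero]

/-- The injective systems on windows of length `L` are bounded below uniformly in `y`, the closed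
interval `[0, 1]` being compact. -/
theorem exists_window_lower_bound {W : Finset ℂ} (hWne : W.Nonempty) {N : ℕ} (hW : W.card ≤ N)
    {A : ℂ → ℂ} (hA : ∀ w ∈ W, A w ≠ 0) (hG : ∀ t : ℝ, t < 0 → expSum W A t ≠ 0) {θ : ℝ}
    (hθ : Set.InjOn (fun w : ℂ => Complex.exp (-2 * Real.pi * w * θ)) W) (L : ℕ) (σ : ℝ) :
    ∃ κ : ℝ, 0 < κ ∧ ∀ y ∈ Set.Icc (0 : ℝ) 1, ∀ c : ℕ → ℂ,
      κ * ∑ t ∈ Finset.range (L + (shiftPoly W).natDegree), ‖c t‖ ^ 2 ≤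
        ∑ e ∈ windowEquations L N θ σ, ‖∑ t ∈ Finset.range (L + (shiftPoly W).natDegree),
          c t * jumpCoeff W A ((t : ℤ) - e.1) (y + e.2)‖ ^ 2 := by
  obtain ⟨κ, hκ, h⟩ := exists_pos_forall_mul_sum_sq_le (windowEquations L N θ σ)
    (a := fun e (t : Fin (L + (shiftPoly W).natDegree)) y =>
      jumpCoeff W A (((t : ℕ) : ℤ) - e.1) (y + e.2))
    (fun e i => (continuous_jumpCoeff W A _).comp (by fun_prop)) (isCompact_Icc (a := (0 : ℝ)) (b := 1))
    (by
      intro y hy c hc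
      set c' : ℕ → ℂ := fun t => if h : t < L + (shiftPoly W).natDegree then c ⟨t, h⟩ else 0
        with hc'
      have hcc : ∀ t : Fin (L + (shiftPoly W).natDegree), c t = c' t := fun t => by
        simp [hc']
      simp only [hcc] at hc
      have hc2 : ∀ e ∈ windowEquations L N θ σ, e.1 ≤ L →
          ∑ i ∈ Finset.range (shiftPoly W).natDegree,
            c' (e.1 + i) * jumpCoeff W A i (y + e.2) = 0 := by
        intro e he heL
        rw [← hc e he, ← sum_fin_mul_jumpCoeff W A heL, ← Fin.sum_univ_eq_sum_range (fun t =>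
          c' t * jumpCoeff W A ((t : ℤ) - e.1) (y + e.2))]
      have key := eq_zero_of_window hWne hW hA hG hθ (L := L) (c := c') (x := y + σ) hy
        (fun m hm => by
          have := hc2 (m, 0) (Finset.mem_union_left _ (Finset.mem_image_of_mem _
            (Finset.mem_range.2 hm))) (by simp; omega)
          simpa using this)
        (fun j hj => by
          have := hc2 (0, σ - j * θ) (Finset.mem_union_right _ (Finset.mem_union_left _
            (Finset.mem_image_of_mem _ (Finset.mem_range.2 hj)))) (by simp)
          simpa [add_sub_assoc] using this)
        (fun j hj => by
          have := hc2 (L, σ - j * θ) (Finset.mem_union_right _ (Finset.mem_union_right _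
            (Finset.mem_image_of_mem _ (Finset.mem_range.2 hj)))) (by simp)
          simpa [add_sub_assoc] using this)
      ext t
      rw [hcc]
      exact key t t.2)
  refine ⟨κ, hκ, fun y hy c => ?_⟩
  have := h y hy (fun t => c t)
  rw [Fin.sum_univ_eq_sum_range (fun t => ‖c t‖ ^ 2)] at this
  refine this.trans (le_of_eq ?_)
  refine Finset.sum_congr rfl fun e _ => ?_
  rw [Fin.sum_univ_eq_sum_range (fun t => c t * jumpCoeff W A ((t : ℤ) - e.1) (y + e.2))]

/-! ### Summability of the half-line exponential sums -/

theorem norm_halfExpSum_le {W : Finset ℂ} (A : ℂ → ℂ) (x : ℝ) :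
    ‖halfExpSum W A x‖ ≤ ∑ w ∈ W, ‖A w‖ * Real.exp (-(2 * Real.pi * |w.re|) * |x|) := by
  have hnorm : ∀ w : ℂ, ‖A w * Complex.exp (2 * Real.pi * w * x)‖ =
      ‖A w‖ * Real.exp (2 * Real.pi * w.re * x) := by
    intro w
    rw [norm_mul, Complex.norm_exp]
    congr 2
    have : (2 * Real.pi * w * x : ℂ) = ((2 * Real.pi * x : ℝ) : ℂ) * w := by push_cast; ring
    rw [this, Complex.re_ofReal_mul]; ring
  have hsub : ∀ V ⊆ W, (∀ w ∈ V, w.re * x = -(|w.re| * |x|)) → ‖expSum V A x‖ ≤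
      ∑ w ∈ W, ‖A w‖ * Real.exp (-(2 * Real.pi * |w.re|) * |x|) := by
    intro V hV hx
    refine (norm_sum_le _ _).trans ?_
    refine le_trans (Finset.sum_le_sum fun w hw => ?_)
      (Finset.sum_le_sum_of_subset_of_nonneg hV fun w _ _ => by positivity)
    rw [hnorm]
    apply le_of_eq
    congr 2
    have := hx w hw
    linear_combination (2 * Real.pi) * this
  unfold halfExpSum
  split_ifs with hx
  · refine hsub _ (Finset.filter_subset _ _) fun w hw => ?_
    rw [abs_of_pos (Finset.mem_filter.1 hw).2, abs_of_neg hx]; ring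
  · rw [norm_neg]
    refine hsub _ (Finset.filter_subset _ _) fun w hw => ?_
    rw [abs_of_nonpos (not_lt.1 (Finset.mem_filter.1 hw).2), abs_of_nonneg (not_lt.1 hx)]; ring

theorem tsum_int_add_eq_fract (f : ℝ → ℝ≥0∞) (x : ℝ) :
    ∑' k : ℤ, f (x + k) = ∑' k : ℤ, f (Int.fract x + k) := by
  rw [← (Equiv.addRight (⌊x⌋ : ℤ)).tsum_eq fun k : ℤ => f (Int.fract x + k)]
  refine tsum_congr fun k => ?_
  congr 1
  have := Int.floor_add_fract x
  simp only [Equiv.coe_addRight]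
  push_cast
  linarith

theorem exists_tsum_exp_neg_abs_le {b : ℝ} (hb : 0 < b) : ∃ H : ℝ≥0∞, H ≠ ⊤ ∧ ∀ x : ℝ,
    ∑' k : ℤ, ENNReal.ofReal (Real.exp (-b * |x + k|)) ≤ H := by
  have hs : Summable fun k : ℤ => Real.exp b * Real.exp (-b * |(k : ℝ)|) := by
    refine Summable.mul_left _ (Summable.of_nat_of_neg ?_ ?_)
    · have := Real.summable_exp_nat_mul_iff.2 (neg_lt_zero.2 hb)
      simpa [mul_comm] using this
    · have := Real.summable_exp_nat_mul_iff.2 (neg_lt_zero.2 hb)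
      simpa [mul_comm] using this
  refine ⟨∑' k : ℤ, ENNReal.ofReal (Real.exp b * Real.exp (-b * |(k : ℝ)|)), ?_, fun x => ?_⟩
  · rw [← ENNReal.ofReal_tsum_of_nonneg (fun _ => by positivity) hs]
    exact ENNReal.ofReal_ne_top
  · rw [tsum_int_add_eq_fract (fun t => ENNReal.ofReal (Real.exp (-b * |t|)))]
    refine ENNReal.tsum_le_tsum fun k => ENNReal.ofReal_le_ofReal ?_
    rw [← Real.exp_add]
    refine Real.exp_le_exp.2 ?_
    have h1 : |(k : ℝ)| ≤ |Int.fract x + k| + 1 := by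
      have h2 := abs_sub_abs_le_abs_sub (k : ℝ) (Int.fract x + k)
      have h3 : |(k : ℝ) - (Int.fract x + k)| ≤ 1 := by
        rw [abs_le]
        constructor <;> linarith [Int.fract_nonneg x, Int.fract_lt_one x]
      linarith
    nlinarith

theorem exists_tsum_enorm_halfExpSum_le {W : Finset ℂ} (hre : ∀ w ∈ W, w.re ≠ 0) (A : ℂ → ℂ) :
    ∃ H : ℝ≥0∞, H ≠ ⊤ ∧ ∀ x : ℝ, ∑' k : ℤ, ‖halfExpSum W A (x + k)‖ₑ ≤ H := by
  have h : ∀ w ∈ W, ∃ H : ℝ≥0∞, H ≠ ⊤ ∧ ∀ x : ℝ,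
      ∑' k : ℤ, ENNReal.ofReal (Real.exp (-(2 * Real.pi * |w.re|) * |x + k|)) ≤ H := by
    intro w hw
    refine exists_tsum_exp_neg_abs_le ?_
    have := abs_pos.2 (hre w hw)
    positivity
  choose! H hH1 hH2 using h
  refine ⟨∑ w ∈ W, ENNReal.ofReal ‖A w‖ * H w, ?_, fun x => ?_⟩
  · exact ENNReal.sum_ne_top.2 fun w hw => ENNReal.mul_ne_top ENNReal.ofReal_ne_top (hH1 w hw)
  · calc ∑' k : ℤ, ‖halfExpSum W A (x + k)‖ₑ
        ≤ ∑' k : ℤ, ∑ w ∈ W, ENNReal.ofReal ‖A w‖ *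
            ENNReal.ofReal (Real.exp (-(2 * Real.pi * |w.re|) * |x + k|)) := by
          refine ENNReal.tsum_le_tsum fun k => ?_
          rw [← ofReal_norm]
          refine (ENNReal.ofReal_le_ofReal (norm_halfExpSum_le A _)).trans (le_of_eq ?_)
          rw [ENNReal.ofReal_sum_of_nonneg fun _ _ => by positivity]
          exact Finset.sum_congr rfl fun w _ => ENNReal.ofReal_mul (norm_nonneg _)
      _ = ∑ w ∈ W, ENNReal.ofReal ‖A w‖ *
            ∑' k : ℤ, ENNReal.ofReal (Real.exp (-(2 * Real.pi * |w.re|) * |x + k|)) := by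
          rw [Summable.tsum_finsetSum fun _ _ => ENNReal.summable]
          simp only [ENNReal.tsum_mul_left]
      _ ≤ _ := Finset.sum_le_sum fun w hw => mul_le_mul_right (hH2 w hw x) _

/-! ### Square-summable estimates for the fibers -/

theorem ENNReal.sq_tsum_mul_le {ι : Type*} (a b : ι → ℝ≥0∞) :
    (∑' i, a i * b i) ^ 2 ≤ (∑' i, b i) * ∑' i, a i ^ 2 * b i := by
  let _ : MeasurableSpace ι := ⊤
  have h := ENNReal.lintegral_mul_le_Lp_mul_Lq (Measure.count : Measure ι)
    (p := 2) (q := 2) (by constructor <;> norm_num)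
    (f := fun i => b i ^ (1 / 2 : ℝ)) (g := fun i => a i * b i ^ (1 / 2 : ℝ))
    measurable_from_top.aemeasurable measurable_from_top.aemeasurable
  simp only [lintegral_count, Pi.mul_apply] at h
  have hb : ∀ i, b i ^ (1 / 2 : ℝ) * b i ^ (1 / 2 : ℝ) = b i := fun i => by
    rw [← ENNReal.rpow_add_of_nonneg _ _ (by norm_num) (by norm_num)]; norm_num
  have e1 : ∀ i, b i ^ (1 / 2 : ℝ) * (a i * b i ^ (1 / 2 : ℝ)) = a i * b i := fun i => by
    rw [mul_left_comm, hb]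
  have e2 : ∀ i, (b i ^ (1 / 2 : ℝ)) ^ (2 : ℝ) = b i := fun i => by
    rw [← ENNReal.rpow_mul]; norm_num
  have e3 : ∀ i, (a i * b i ^ (1 / 2 : ℝ)) ^ (2 : ℝ) = a i ^ 2 * b i := fun i => by
    rw [ENNReal.mul_rpow_of_nonneg _ _ (by norm_num), e2]; norm_num
  simp only [e1, e2, e3] at h
  have h2 := pow_le_pow_left₀ zero_le h 2
  refine h2.trans (le_of_eq ?_)
  rw [mul_pow]
  congr 1
  · rw [← ENNReal.rpow_natCast, ← ENNReal.rpow_mul]; norm_num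
  · rw [← ENNReal.rpow_natCast, ← ENNReal.rpow_mul]; norm_num

/-- The fiber `∑_k c_k h(x + k)` of the Gabor analysis operator, `h = halfExpSum W A`. -/
noncomputable def fiberSum (W : Finset ℂ) (A : ℂ → ℂ) (c : ℤ → ℂ) (x : ℝ) : ℂ :=
  ∑' k : ℤ, c k * halfExpSum W A (x + k)

/-- Young's inequality for the convolution of an `ℓ²` and an `ℓ¹` sequence. -/
theorem tsum_enorm_fiberSum_sub_int_le {W : Finset ℂ} {A : ℂ → ℂ} {H : ℝ≥0∞}
    (hH : ∀ x : ℝ, ∑' k : ℤ, ‖halfExpSum W A (x + k)‖ₑ ≤ H) (c : ℤ → ℂ) (x : ℝ) :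
    ∑' m : ℤ, ‖fiberSum W A c (x - m)‖ₑ ^ 2 ≤ H ^ 2 * ∑' k : ℤ, ‖c k‖ₑ ^ 2 := by
  calc ∑' m : ℤ, ‖fiberSum W A c (x - m)‖ₑ ^ 2
      ≤ ∑' m : ℤ, H * ∑' k : ℤ, ‖c k‖ₑ ^ 2 * ‖halfExpSum W A (x - m + k)‖ₑ := by
        refine ENNReal.tsum_le_tsum fun m => ?_
        calc ‖fiberSum W A c (x - m)‖ₑ ^ 2
            ≤ (∑' k : ℤ, ‖c k‖ₑ * ‖halfExpSum W A (x - m + k)‖ₑ) ^ 2 := by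
              refine pow_le_pow_left₀ zero_le ?_ 2
              refine enorm_tsum_le_tsum_enorm.trans (le_of_eq ?_)
              simp only [enorm_mul]
          _ ≤ _ := (ENNReal.sq_tsum_mul_le _ _).trans (mul_le_mul_left (hH _) _)
    _ = H * ∑' k : ℤ, ‖c k‖ₑ ^ 2 * ∑' m : ℤ, ‖halfExpSum W A ((x + k) + (m : ℤ))‖ₑ := by
        rw [ENNReal.tsum_mul_left, ENNReal.tsum_comm]
        congr 1
        refine tsum_congr fun k => ?_
        rw [ENNReal.tsum_mul_left]
        congr 1
        rw [← (Equiv.neg ℤ).tsum_eq]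
        refine tsum_congr fun m => ?_
        congr 2
        simp only [Equiv.neg_apply]
        push_cast
        ring
    _ ≤ H * ∑' k : ℤ, ‖c k‖ₑ ^ 2 * H := by
        refine mul_le_mul_right (ENNReal.tsum_le_tsum fun k => mul_le_mul_right (hH _) _) _
    _ = _ := by rw [ENNReal.tsum_mul_right]; ring

theorem tsum_enorm_fiberSum_le {W : Finset ℂ} {A : ℂ → ℂ} {H : ℝ≥0∞}
    (hH : ∀ x : ℝ, ∑' k : ℤ, ‖halfExpSum W A (x + k)‖ₑ ≤ H) (F : Finset ℝ) (L : ℕ) (hL : 0 < L)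
    (c : ℤ → ℂ) (y : ℝ) :
    ∑' l : periodicSet F L, ‖fiberSum W A c (y - l)‖ₑ ^ 2 ≤
      F.card * H ^ 2 * ∑' k : ℤ, ‖c k‖ₑ ^ 2 := by
  have hinj : Function.Injective fun l : periodicSet F L =>
      ((⟨l.2.choose, l.2.choose_spec.1⟩, l.2.choose_spec.2.choose) : F × ℤ) := by
    intro l l' h
    rw [Prod.mk.injEq, Subtype.mk.injEq] at h
    have e1 := l.2.choose_spec.2.choose_spec
    have e2 := l'.2.choose_spec.2.choose_spec
    ext
    rw [e1, e2, h.2, h.1]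
  calc ∑' l : periodicSet F L, ‖fiberSum W A c (y - l)‖ₑ ^ 2
      = ∑' l : periodicSet F L, (fun q : F × ℤ =>
          ‖fiberSum W A c (y - (q.1 + q.2 * L))‖ₑ ^ 2)
          (⟨l.2.choose, l.2.choose_spec.1⟩, l.2.choose_spec.2.choose) := by
        refine tsum_congr fun l => ?_
        have e1 := l.2.choose_spec.2.choose_spec
        simp only
        rw [← e1]
    _ ≤ ∑' q : F × ℤ, ‖fiberSum W A c (y - (q.1 + q.2 * L))‖ₑ ^ 2 :=
        ENNReal.tsum_comp_le_tsum_of_injective hinj _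
    _ = ∑' s : F, ∑' m : ℤ, ‖fiberSum W A c (y - (s + m * L))‖ₑ ^ 2 :=
        ENNReal.tsum_prod (f := fun (s : F) (m : ℤ) => ‖fiberSum W A c (y - (s + m * L))‖ₑ ^ 2)
    _ ≤ ∑' s : F, H ^ 2 * ∑' k : ℤ, ‖c k‖ₑ ^ 2 := by
        refine ENNReal.tsum_le_tsum fun s => ?_
        refine le_trans ?_ (tsum_enorm_fiberSum_sub_int_le hH c (y - s))
        have hi : Function.Injective fun m : ℤ => m * (L : ℤ) := fun m m' h =>
          mul_right_cancel₀ (by omega : (L : ℤ) ≠ 0) h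
        refine le_trans (le_of_eq ?_) (ENNReal.tsum_comp_le_tsum_of_injective hi
          fun m : ℤ => ‖fiberSum W A c (y - s - m)‖ₑ ^ 2)
        refine tsum_congr fun m => ?_
        congr 3
        push_cast; ring
    _ = _ := by
        rw [tsum_fintype, Finset.sum_const, Finset.card_univ, Fintype.card_coe, nsmul_eq_mul,
          mul_assoc]

/-- The annihilating polynomial turns the fiber sums into finite sums of jump coefficients. -/
theorem sum_shiftPoly_coeff_mul_fiberSum {W : Finset ℂ} {A : ℂ → ℂ} {H : ℝ≥0∞} (hHt : H ≠ ⊤)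
    (hH : ∀ x : ℝ, ∑' k : ℤ, ‖halfExpSum W A (x + k)‖ₑ ≤ H) {c : ℤ → ℂ} {C : ℝ}
    (hc : ∀ k, ‖c k‖ ≤ C) {s : ℝ} (hs : s ∈ Set.Ico (0 : ℝ) 1) (K : ℤ) {L m : ℕ} (hm : m ≤ L) :
    ∑ j ∈ Finset.range ((shiftPoly W).natDegree + 1),
      (shiftPoly W).coeff j * fiberSum W A c (s - (K + m) - j) =
    ∑ t ∈ Finset.range (L + (shiftPoly W).natDegree),
      c (K + t) * jumpCoeff W A ((t : ℤ) - m) s := by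
  have hsum : ∀ x : ℝ, Summable fun k : ℤ => c k * halfExpSum W A (x + k) := by
    intro x
    have h1 : Summable fun k : ℤ => ‖halfExpSum W A (x + k)‖ :=
      tsum_enorm_ne_top_iff_summable_norm.1 (ne_top_of_le_ne_top hHt (hH x))
    refine Summable.of_norm_bounded (h1.mul_left C) fun k => ?_
    rw [norm_mul]
    exact mul_le_mul_of_nonneg_right (hc k) (norm_nonneg _)
  simp only [fiberSum, ← tsum_mul_left]
  rw [← Summable.tsum_finsetSum fun j _ => (hsum _).mul_left _]
  have hk : ∀ k : ℤ, ∑ j ∈ Finset.range ((shiftPoly W).natDegree + 1),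
      (shiftPoly W).coeff j * (c k * halfExpSum W A (s - (K + m) - j + k)) =
      c k * jumpCoeff W A (k - (K + m)) s := by
    intro k
    rw [← sum_shiftPoly_coeff_mul_halfExpSum W A hs, Finset.mul_sum]
    refine Finset.sum_congr rfl fun j _ => ?_
    have : s - (K + m) - j + k = s + ((k - (K + m) : ℤ) : ℝ) - j := by push_cast; ring
    rw [this]; ring
  simp only [hk]
  have hinj : Set.InjOn (fun t : ℕ => K + (t : ℤ))
      (Finset.range (L + (shiftPoly W).natDegree)) := fun t _ t' _ h => by
    simp only at h; omega
  rw [tsum_eq_sum (s := (Finset.range (L + (shiftPoly W).natDegree)).image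
    fun t : ℕ => K + (t : ℤ)), Finset.sum_image hinj]
  · refine Finset.sum_congr rfl fun t _ => ?_
    congr 2; ring
  · intro k hk
    by_cases h1 : k < K + m
    · rw [jumpCoeff_of_neg W A (by omega), mul_zero]
    · rw [jumpCoeff_of_natDegree_le W A, mul_zero]
      by_contra h2
      apply hk
      rw [Finset.mem_image]
      exact ⟨(k - K).toNat, by rw [Finset.mem_range]; omega, by omega⟩

theorem enorm_sum_mul_sq_le {ι : Type*} (s : Finset ι) (a b : ι → ℂ) :
    ‖∑ j ∈ s, a j * b j‖ₑ ^ 2 ≤ (∑ j ∈ s, ‖a j‖ₑ ^ 2) * ∑ j ∈ s, ‖b j‖ₑ ^ 2 := by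
  have h : ‖∑ j ∈ s, a j * b j‖ ^ 2 ≤ (∑ j ∈ s, ‖a j‖ ^ 2) * ∑ j ∈ s, ‖b j‖ ^ 2 := by
    refine le_trans ?_ (Finset.sum_mul_sq_le_sq_mul_sq s _ _)
    refine pow_le_pow_left₀ (norm_nonneg _) ((norm_sum_le _ _).trans (le_of_eq ?_)) 2
    simp only [norm_mul]
  have h2 := ENNReal.ofReal_le_ofReal h
  rw [ENNReal.ofReal_mul (Finset.sum_nonneg fun _ _ => by positivity),
    ENNReal.ofReal_sum_of_nonneg fun _ _ => by positivity,
    ENNReal.ofReal_sum_of_nonneg fun _ _ => by positivity] at h2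
  simpa only [ENNReal.ofReal_pow (norm_nonneg _), ofReal_norm] using h2

theorem tsum_int_eq_tsum_sum_range (f : ℤ → ℝ≥0∞) {L : ℕ} (hL : 0 < L) :
    ∑' k : ℤ, f k = ∑' K : ℤ, ∑ t ∈ Finset.range L, f (K * L + t) := by
  have : NeZero L := ⟨hL.ne'⟩
  rw [← (Int.divModEquiv L).symm.tsum_eq]
  refine (ENNReal.tsum_prod (f := fun (K : ℤ) (t : Fin L) => f (K * L + (t : ℕ)))).trans ?_
  refine tsum_congr fun K => ?_
  rw [tsum_fintype]
  exact Fin.sum_univ_eq_sum_range (fun t => f (K * L + t)) L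

/-- A uniform lower bound on windows yields the lower frame bound for the fibers over all points
`y` whose window equations only involve frequencies in `Λ`. -/
theorem le_tsum_enorm_fiberSum {W : Finset ℂ} {A : ℂ → ℂ} {H : ℝ≥0∞} (hHt : H ≠ ⊤)
    (hH : ∀ x : ℝ, ∑' k : ℤ, ‖halfExpSum W A (x + k)‖ₑ ≤ H) {L : ℕ} (hL : 0 < L)
    (E : Finset (ℕ × ℝ)) {Λ : Set ℝ} {y κ : ℝ}
    (hκ : ∀ c : ℕ → ℂ, κ * ∑ t ∈ Finset.range (L + (shiftPoly W).natDegree), ‖c t‖ ^ 2 ≤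
        ∑ e ∈ E, ‖∑ t ∈ Finset.range (L + (shiftPoly W).natDegree),
          c t * jumpCoeff W A ((t : ℤ) - e.1) (y + e.2)‖ ^ 2)
    (hE1 : ∀ e ∈ E, e.1 ≤ L) (hE2 : ∀ e ∈ E, y + e.2 ∈ Set.Ico (0 : ℝ) 1)
    (hΛ : ∀ e ∈ E, ∀ K : ℤ, ∀ j ≤ (shiftPoly W).natDegree,
      (K * L + e.1 - e.2 + j : ℝ) ∈ Λ)
    {c : ℤ → ℂ} {C : ℝ} (hc : ∀ k, ‖c k‖ ≤ C) :
    ENNReal.ofReal κ * ∑' k : ℤ, ‖c k‖ₑ ^ 2 ≤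
      (∑ _e ∈ E, (∑ j ∈ Finset.range ((shiftPoly W).natDegree + 1),
        ‖(shiftPoly W).coeff j‖ₑ ^ 2) * ((shiftPoly W).natDegree + 1 : ℕ)) *
      ∑' l : Λ, ‖fiberSum W A c (y - l)‖ₑ ^ 2 := by
  set n := (shiftPoly W).natDegree with hn
  set P : ℝ≥0∞ := ∑ j ∈ Finset.range (n + 1), ‖(shiftPoly W).coeff j‖ₑ ^ 2 with hP
  set T : ℝ≥0∞ := ∑' l : Λ, ‖fiberSum W A c (y - l)‖ₑ ^ 2 with hT
  have hwin : ∀ K : ℤ, ENNReal.ofReal κ * ∑ t ∈ Finset.range L, ‖c (K * L + t)‖ₑ ^ 2 ≤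
      ∑ e ∈ E, P * ∑ j ∈ Finset.range (n + 1),
        ‖fiberSum W A c (y - (K * L + e.1 - e.2 + j))‖ₑ ^ 2 := by
    intro K
    have h1 := ENNReal.ofReal_le_ofReal (hκ fun t => c (K * L + t))
    rw [ENNReal.ofReal_mul' (Finset.sum_nonneg fun _ _ => by positivity),
      ENNReal.ofReal_sum_of_nonneg (fun _ _ => by positivity),
      ENNReal.ofReal_sum_of_nonneg (fun _ _ => by positivity)] at h1
    simp only [ENNReal.ofReal_pow (norm_nonneg _), ofReal_norm] at h1
    refine le_trans (mul_le_mul_right (Finset.sum_le_sum_of_subset ?_) _) (h1.trans ?_)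
    · exact Finset.range_mono (by omega)
    · refine Finset.sum_le_sum fun e he => ?_
      rw [← sum_shiftPoly_coeff_mul_fiberSum hHt hH hc (hE2 e he) (K * L) (hE1 e he)]
      refine (enorm_sum_mul_sq_le _ _ _).trans (le_of_eq ?_)
      congr 1
      refine Finset.sum_congr rfl fun j _ => ?_
      congr 3
      push_cast; ring
  rw [tsum_int_eq_tsum_sum_range _ hL, ← ENNReal.tsum_mul_left]
  refine (ENNReal.tsum_le_tsum hwin).trans ?_
  rw [Summable.tsum_finsetSum fun _ _ => ENNReal.summable, Finset.sum_mul]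
  refine Finset.sum_le_sum fun e he => ?_
  rw [ENNReal.tsum_mul_left, mul_assoc]
  refine mul_le_mul_right ?_ _
  rw [Summable.tsum_finsetSum fun _ _ => ENNReal.summable, ← nsmul_eq_mul]
  refine (Finset.sum_le_card_nsmul _ _ T fun j hj => ?_).trans (by rw [Finset.card_range])
  rw [Finset.mem_range] at hj
  have hinj : Function.Injective fun K : ℤ =>
      (⟨(K * L + e.1 - e.2 + j : ℝ), hΛ e he K j (by omega)⟩ : Λ) := by
    intro K K' h
    have h1 := congrArg Subtype.val h
    simp only at h1
    have hL' : (L : ℝ) ≠ 0 := by exact_mod_cast hL.ne'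
    have h2 : (K : ℝ) * L = K' * L := by linarith
    exact_mod_cast mul_right_cancel₀ hL' h2
  exact ENNReal.tsum_comp_le_tsum_of_injective hinj fun l : Λ =>
    ‖fiberSum W A c (y - l)‖ₑ ^ 2

/-! ### Periodization and Parseval's identity -/

theorem lintegral_eq_lintegral_tsum_add_int {f : ℝ → ℝ≥0∞} (hf : Measurable f) :
    ∫⁻ x, f x = ∫⁻ y in Set.Ioc (0 : ℝ) 1, ∑' k : ℤ, f (y + k) := by
  rw [lintegral_tsum (f := fun (k : ℤ) (y : ℝ) => f (y + k))
      fun k => (hf.comp (by fun_prop)).aemeasurable, ← setLIntegral_univ,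
    ← iUnion_Ioc_intCast ℝ, lintegral_iUnion (fun _ => measurableSet_Ioc)
      (Set.pairwise_disjoint_Ioc_intCast ℝ)]
  refine tsum_congr fun k => ?_
  rw [← (measurePreserving_add_right volume (k : ℝ)).setLIntegral_comp_preimage_emb
    (measurableEmbedding_addRight _)]
  congr 2
  ext x
  simp only [Set.mem_preimage, Set.mem_Ioc]
  constructor <;> rintro ⟨h1, h2⟩ <;> constructor <;> linarith

/-- Parseval's identity on `ℝ`: the integer frequencies of an integrable `q` see exactly its
periodization. -/
theorem tsum_enorm_integral_fourier_mul {q : ℝ → ℂ} (hq : Measurable q)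
    (hqi : Integrable q) (hfin : ∫⁻ y in Set.Ioc (0 : ℝ) 1, ‖∑' k : ℤ, q (y + k)‖ₑ ^ 2 ≠ ⊤) :
    ∑' n : ℤ, ‖∫ y : ℝ, Complex.exp (-2 * Real.pi * Complex.I * n * y) * q y‖ₑ ^ 2 =
      ∫⁻ y in Set.Ioc (0 : ℝ) 1, ‖∑' k : ℤ, q (y + k)‖ₑ ^ 2 := by
  have hqk : ∀ k : ℤ, Measurable fun y : ℝ => q (y + k) := fun k => hq.comp (by fun_prop)
  have hfin1 : ∫⁻ y in Set.Ioc (0 : ℝ) 1, ∑' k : ℤ, ‖q (y + k)‖ₑ ≠ ⊤ := by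
    rw [← lintegral_eq_lintegral_tsum_add_int hq.enorm]
    exact hqi.2.ne
  set Φ : ℝ → ℂ := fun y => ∑' k : ℤ, q (y + k) with hΦ
  have hΦm : AEStronglyMeasurable Φ (volume.restrict (Set.Ioc (0 : ℝ) 1)) :=
    (Measurable.tsum hqk).aestronglyMeasurable
  have hΦL : MemLp Φ 2 (volume.restrict (Set.Ioc (0 : ℝ) 1)) := by
    refine ⟨hΦm, ?_⟩
    rw [eLpNorm_lt_top_iff_lintegral_rpow_enorm_lt_top (by norm_num) (by norm_num)]
    simpa using lt_top_iff_ne_top.2 hfin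
  have hexp : ∀ (n : ℤ) (y : ℝ), ‖Complex.exp (-2 * Real.pi * Complex.I * n * y)‖ₑ = 1 := by
    intro n y
    have : (-2 * Real.pi * Complex.I * n * y : ℂ) = ((-2 * Real.pi * n * y : ℝ) : ℂ) *
        Complex.I := by push_cast; ring
    rw [this, ← ofReal_norm, Complex.norm_exp_ofReal_mul_I, ENNReal.ofReal_one]
  have hper : ∀ (n k : ℤ) (y : ℝ), Complex.exp (-2 * Real.pi * Complex.I * n * ((y + k : ℝ) : ℂ)) =
      Complex.exp (-2 * Real.pi * Complex.I * n * y) := by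
    intro n k y
    refine Complex.exp_eq_exp_iff_exists_int.2 ⟨-(n * k), ?_⟩
    push_cast; ring
  -- the integrals over `ℝ` are the Fourier coefficients of the periodization
  have hcoef : ∀ n : ℤ, ∫ y : ℝ, Complex.exp (-2 * Real.pi * Complex.I * n * y) * q y =
      fourierCoeffOn (zero_lt_one (α := ℝ)) Φ n := by
    intro n
    have hi : Integrable fun y : ℝ => Complex.exp (-2 * Real.pi * Complex.I * n * y) * q y := by
      refine hqi.norm.mono' (by fun_prop) (Eventually.of_forall fun y => le_of_eq ?_)
      rw [norm_mul]
      have := hexp n y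
      rw [← ofReal_norm, ENNReal.ofReal_eq_one] at this
      rw [this, one_mul]
    have h1 := (hi.hasSum_intervalIntegral 0).tsum_eq
    rw [← h1, fourierCoeffOn_eq_integral]
    simp only [sub_zero, ne_eq, one_ne_zero, not_false_eq_true, div_self, one_smul]
    rw [intervalIntegral.integral_of_le zero_le_one]
    have h2 : ∀ k : ℤ, ∫ y in (0 + (k : ℝ))..(0 + (k : ℝ) + 1),
        Complex.exp (-2 * Real.pi * Complex.I * n * y) * q y =
        ∫ y in Set.Ioc (0 : ℝ) 1, Complex.exp (-2 * Real.pi * Complex.I * n * y) * q (y + k) := by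
      intro k
      have h3 := intervalIntegral.integral_comp_add_right (a := 0) (b := 1)
        (fun y : ℝ => Complex.exp (-2 * Real.pi * Complex.I * n * y) * q y) (k : ℝ)
      rw [add_comm (0 + (k : ℝ)) 1, ← add_assoc, add_zero, ← h3,
        intervalIntegral.integral_of_le zero_le_one]
      simp only [hper]
    simp only [h2]
    rw [← integral_tsum]
    · refine integral_congr_ae (Eventually.of_forall fun y => ?_)
      simp only [tsum_mul_left, smul_eq_mul, hΦ]
      congr 1
      rw [fourier_coe_apply]
      congr 1
      push_cast
      simp
    · intro k
      exact ((by fun_prop : Measurable fun y : ℝ =>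
        Complex.exp (-2 * Real.pi * Complex.I * n * y)).mul (hqk k)).aestronglyMeasurable
    · simp only [enorm_mul, hexp, one_mul]
      rwa [← lintegral_tsum fun k => (hqk k).enorm.aemeasurable]
  have hP := hasSum_sq_fourierCoeffOn (zero_lt_one (α := ℝ)) hΦL
  simp only [sub_zero, inv_one, one_smul] at hP
  rw [intervalIntegral.integral_of_le zero_le_one] at hP
  have hsq : ∀ z : ℂ, ‖z‖ₑ ^ 2 = ENNReal.ofReal (‖z‖ ^ 2) := fun z => by
    rw [ENNReal.ofReal_pow (norm_nonneg _), ofReal_norm]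
  simp only [hcoef, hsq]
  rw [← ENNReal.ofReal_tsum_of_nonneg (fun _ => by positivity) hP.summable, hP.tsum_eq,
    ofReal_integral_eq_lintegral_ofReal]
  · exact (memLp_two_iff_integrable_sq_norm hΦm).1 hΦL
  · exact Eventually.of_forall fun y => by positivity

/-! ### The Fourier transform of the window -/

section

open FourierTransform SchwartzMap

/-- On `L¹ ∩ L²` the inverse Fourier transform of `L²` is given by the Fourier integral. -/
theorem fourierInv_toLp_ae_eq {f : ℝ → ℂ} (h1 : Integrable f) (h2 : MemLp f 2 volume) :
    ((𝓕⁻ (h2.toLp f) : Lp ℂ 2 (volume : Measure ℝ)) : ℝ → ℂ) =ᵐ[volume] 𝓕⁻ f := by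
  have hcont : Continuous (𝓕⁻ f) := by
    have : Continuous (VectorFourier.fourierIntegral Real.fourierChar volume (-innerₗ ℝ) f) :=
      VectorFourier.fourierIntegral_continuous Real.continuous_fourierChar
        (by simpa using! continuous_inner.neg) h1
    exact this
  refine ae_eq_of_integral_contDiff_smul_eq ((Lp.memLp _).locallyIntegrable (by norm_num))
    hcont.locallyIntegrable fun φ φ_smooth φ_cpt => ?_
  have hg₁ : HasCompactSupport (Complex.ofRealCLM ∘ φ) := φ_cpt.comp_left rfl
  have hg₂ : ContDiff ℝ (⊤ : ℕ∞) (Complex.ofRealCLM ∘ φ) := by fun_prop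
  set ψ : 𝓢(ℝ, ℂ) := hg₁.toSchwartzMap hg₂ with hψ
  have hψφ : ∀ x, ψ x = (φ x : ℂ) := fun x => by simp [hψ]
  calc ∫ x, φ x • ((𝓕⁻ (h2.toLp f) : Lp ℂ 2 (volume : Measure ℝ)) : ℝ → ℂ) x
      = ∫ x, ψ x • ((𝓕⁻ (h2.toLp f) : Lp ℂ 2 (volume : Measure ℝ)) : ℝ → ℂ) x := by
        simp only [hψφ]; rfl
    _ = (Lp.toTemperedDistribution (𝓕⁻ (h2.toLp f) : Lp ℂ 2 (volume : Measure ℝ))) ψ :=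
        (Lp.toTemperedDistribution_apply _ _).symm
    _ = (Lp.toTemperedDistribution (h2.toLp f)) (𝓕⁻ ψ) := by
        rw [← Lp.fourierInv_toTemperedDistribution_eq, TemperedDistribution.fourierInv_apply]
    _ = ∫ x, (𝓕⁻ ψ) x • (h2.toLp f) x := Lp.toTemperedDistribution_apply _ _
    _ = ∫ x, (𝓕⁻ (ψ : ℝ → ℂ)) x • f x := by
        refine integral_congr_ae ?_
        filter_upwards [h2.coeFn_toLp] with x hx
        rw [hx, fourierInv_coe]
    _ = ∫ x, ψ x • (𝓕⁻ f) x := by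
        have := VectorFourier.integral_fourierIntegral_smul_eq_flip (μ := (volume : Measure ℝ))
          (ν := (volume : Measure ℝ)) (L := -innerₗ ℝ) (f := ψ) (g := f)
          Real.continuous_fourierChar (by simpa using! continuous_inner.neg) ψ.integrable h1
        refine this.trans ?_
        have hflip : (-innerₗ ℝ : ℝ →ₗ[ℝ] ℝ →ₗ[ℝ] ℝ).flip = -innerₗ ℝ := by
          ext; simp
        rw [hflip]
        rfl
    _ = _ := by simp only [hψφ]; rfl

theorem integrable_halfExpSum {W : Finset ℂ} (hre : ∀ w ∈ W, w.re ≠ 0) (A : ℂ → ℂ) :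
    Integrable (halfExpSum W A) := by
  have hre2 : ∀ w : ℂ, (2 * Real.pi * w : ℂ).re = 2 * Real.pi * w.re := fun w => by
    have : (2 * Real.pi * w : ℂ) = ((2 * Real.pi : ℝ) : ℂ) * w := by push_cast; ring
    rw [this, Complex.re_ofReal_mul]
  rw [← integrableOn_univ, ← Set.Iio_union_Ici (a := (0 : ℝ))]
  refine IntegrableOn.union ?_ ?_
  · refine IntegrableOn.congr_fun (f := expSum (W.filter fun w => 0 < w.re) A) ?_
      (fun x hx => by rw [halfExpSum, if_pos (Set.mem_Iio.1 hx)]) measurableSet_Iio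
    refine integrable_finsetSum _ fun w hw => Integrable.const_mul ?_ _
    refine (integrableOn_exp_mul_complex_Iic ?_ 0).mono_set Set.Iio_subset_Iic_self
    rw [hre2]
    have := (Finset.mem_filter.1 hw).2
    positivity
  · refine IntegrableOn.congr_fun (f := fun x => -expSum (W.filter fun w => ¬ 0 < w.re) A x) ?_
      (fun x hx => by rw [halfExpSum, if_neg (not_lt.2 hx)]) measurableSet_Ici
    refine Integrable.neg ?_
    refine integrable_finsetSum _ fun w hw => Integrable.const_mul ?_ _
    have hw' := Finset.mem_filter.1 hw
    refine (integrableOn_Ici_iff_integrableOn_Ioi).2 (integrableOn_exp_mul_complex_Ioi ?_ 0)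
    rw [hre2]
    have := lt_of_le_of_ne (not_lt.1 hw'.2) (hre w hw'.1)
    have hpi := Real.pi_pos
    nlinarith

theorem memLp_halfExpSum {W : Finset ℂ} (hre : ∀ w ∈ W, w.re ≠ 0) (A : ℂ → ℂ) :
    MemLp (halfExpSum W A) 2 volume := by
  have hm := (measurable_halfExpSum W A).aestronglyMeasurable (μ := volume)
  rw [memLp_two_iff_integrable_sq_norm hm]
  refine ((integrable_halfExpSum hre A).norm.const_mul (∑ w ∈ W, ‖A w‖)).mono' (hm.norm.pow 2)
    (Eventually.of_forall fun x => ?_)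
  rw [Real.norm_of_nonneg (by positivity), sq]
  refine mul_le_mul_of_nonneg_right ((norm_halfExpSum_le A x).trans ?_) (norm_nonneg _)
  refine Finset.sum_le_sum fun w _ => mul_le_of_le_one_right (norm_nonneg _) ?_
  rw [Real.exp_le_one_iff, neg_mul]
  exact neg_nonpos.2 (by positivity)

/-- The inverse Fourier transform of `halfExpSum W A` is the rational function with simple poles
at the points `i w`. -/
theorem fourierInv_halfExpSum {W : Finset ℂ} (hre : ∀ w ∈ W, w.re ≠ 0) (A : ℂ → ℂ) (t : ℝ) :
    𝓕⁻ (halfExpSum W A) t =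
      ∑ w ∈ W, A w / (2 * Real.pi * Complex.I) / ((t : ℂ) - Complex.I * w) := by
  set z : ℂ → ℂ := fun w => 2 * Real.pi * w + 2 * Real.pi * t * Complex.I with hz
  have hzre : ∀ w, (z w).re = 2 * Real.pi * w.re := by
    intro w
    have : z w = ((2 * Real.pi : ℝ) : ℂ) * w + ((2 * Real.pi * t : ℝ) : ℂ) * Complex.I := by
      simp only [hz]; push_cast; ring
    rw [this, Complex.add_re, Complex.re_ofReal_mul, Complex.re_ofReal_mul]
    simp
  have hval : ∀ w ∈ W, A w / (2 * Real.pi * Complex.I) / ((t : ℂ) - Complex.I * w) =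
      A w * (1 / z w) := by
    intro w _
    have : z w = (2 * Real.pi * Complex.I) * ((t : ℂ) - Complex.I * w) := by
      simp only [hz]
      linear_combination (2 * Real.pi * w) * Complex.I_sq
    rw [this, div_div, mul_one_div]
  rw [Real.fourierInv_eq']
  set f : ℝ → ℂ := fun v => Complex.exp (((2 * Real.pi * inner ℝ v t : ℝ) : ℂ) * Complex.I) •
    halfExpSum W A v with hf
  have hexp : ∀ (w : ℂ) (v : ℝ), Complex.exp (((2 * Real.pi * inner ℝ v t : ℝ) : ℂ) * Complex.I) *
      (A w * Complex.exp (2 * Real.pi * w * v)) = A w * Complex.exp (z w * v) := by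
    intro w v
    rw [mul_left_comm, ← Complex.exp_add]
    congr 2
    simp only [hz, RCLike.inner_apply, conj_trivial]
    push_cast; ring
  have hneg : ∀ v ∈ Set.Iic (0 : ℝ), v ≠ 0 → f v =
      ∑ w ∈ W.filter fun w => 0 < w.re, A w * Complex.exp (z w * v) := by
    intro v hv hv0
    simp only [hf, smul_eq_mul]
    rw [halfExpSum, if_pos (lt_of_le_of_ne hv hv0), expSum, Finset.mul_sum]
    exact Finset.sum_congr rfl fun w _ => hexp w v
  have hpos : ∀ v ∈ Set.Ioi (0 : ℝ), f v =
      -∑ w ∈ W.filter fun w => ¬ 0 < w.re, A w * Complex.exp (z w * v) := by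
    intro v hv
    simp only [hf, smul_eq_mul]
    rw [halfExpSum, if_neg (not_lt.2 (le_of_lt hv)), expSum, mul_neg, Finset.mul_sum]
    exact congrArg Neg.neg (Finset.sum_congr rfl fun w _ => hexp w v)
  have hfi : Integrable f := by
    refine (integrable_halfExpSum hre A).norm.mono' ?_ (Eventually.of_forall fun v => le_of_eq ?_)
    · exact ((by fun_prop : Measurable fun v : ℝ => Complex.exp
        (((2 * Real.pi * inner ℝ v t : ℝ) : ℂ) * Complex.I)).mul
          (measurable_halfExpSum W A)).aestronglyMeasurable
    · simp only [hf]
      rw [norm_smul, Complex.norm_exp_ofReal_mul_I, one_mul]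
  rw [← intervalIntegral.integral_Iic_add_Ioi (b := (0 : ℝ)) hfi.integrableOn hfi.integrableOn,
    setIntegral_congr_fun measurableSet_Ioi hpos,
    setIntegral_congr_ae (g := fun v : ℝ => ∑ w ∈ W.filter fun w => 0 < w.re,
      A w * Complex.exp (z w * v)) measurableSet_Iic (by
        filter_upwards [compl_mem_ae_iff.2 (measure_singleton (0 : ℝ))] with v hv hv'
        exact hneg v hv' hv), integral_neg, integral_finsetSum, integral_finsetSum,
    Finset.sum_congr rfl hval, ← Finset.sum_filter_add_sum_filter_not W (fun w => 0 < w.re),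
    ← Finset.sum_neg_distrib]
  · congr 1
    · refine Finset.sum_congr rfl fun w hw => ?_
      have h0 : 0 < (z w).re := by
        rw [hzre]; have := (Finset.mem_filter.1 hw).2; positivity
      rw [integral_const_mul, integral_exp_mul_complex_Iic h0]
      simp
    · refine Finset.sum_congr rfl fun w hw => ?_
      have hw' := Finset.mem_filter.1 hw
      have h0 : (z w).re < 0 := by
        rw [hzre]
        have := lt_of_le_of_ne (not_lt.1 hw'.2) (hre w hw'.1)
        have hpi := Real.pi_pos
        nlinarith
      rw [integral_const_mul, integral_exp_mul_complex_Ioi h0]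
      simp [neg_div]
  · intro w hw
    have hw' := Finset.mem_filter.1 hw
    have h0 : (z w).re < 0 := by
      rw [hzre]
      have := lt_of_le_of_ne (not_lt.1 hw'.2) (hre w hw'.1)
      have hpi := Real.pi_pos
      nlinarith
    exact (integrableOn_exp_mul_complex_Ioi h0 0).const_mul _
  · intro w hw
    have h0 : 0 < (z w).re := by
      rw [hzre]; have := (Finset.mem_filter.1 hw).2; positivity
    exact (integrableOn_exp_mul_complex_Iic h0 0).const_mul _

/-- The modulated translate `e^{-2πi(y - λ)μ} h(y - λ)`, the Fourier transform of the
time-frequency shift by `(λ, μ)` of the inverse transform of `h`. -/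
noncomputable def shiftedSpectrum (lam mu : ℝ) (h : ℝ → ℂ) (y : ℝ) : ℂ :=
  Complex.exp (-2 * Real.pi * Complex.I * mu * (y - lam)) * h (y - lam)

theorem norm_exp_shiftedSpectrum (lam mu y : ℝ) :
    ‖Complex.exp (-2 * Real.pi * Complex.I * mu * (y - lam))‖ = 1 := by
  have : (-2 * Real.pi * Complex.I * mu * (y - lam) : ℂ) =
      ((-2 * Real.pi * mu * (y - lam) : ℝ) : ℂ) * Complex.I := by push_cast; ring
  rw [this, Complex.norm_exp_ofReal_mul_I]

theorem aestronglyMeasurable_shiftedSpectrum (lam mu : ℝ) {h : ℝ → ℂ}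
    (hh : AEStronglyMeasurable h volume) :
    AEStronglyMeasurable (shiftedSpectrum lam mu h) volume :=
  ((by fun_prop : Continuous fun y : ℝ =>
    Complex.exp (-2 * Real.pi * Complex.I * mu * (y - lam))).aestronglyMeasurable).mul
      (hh.comp_measurePreserving (measurePreserving_sub_right volume lam))

theorem integrable_shiftedSpectrum (lam mu : ℝ) {h : ℝ → ℂ} (hh : Integrable h) :
    Integrable (shiftedSpectrum lam mu h) := by
  refine (hh.comp_sub_right lam).norm.mono' (aestronglyMeasurable_shiftedSpectrum lam mu hh.1)
    (Eventually.of_forall fun y => le_of_eq ?_)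
  rw [shiftedSpectrum, norm_mul, norm_exp_shiftedSpectrum, one_mul]

theorem memLp_shiftedSpectrum (lam mu : ℝ) {h : ℝ → ℂ} (hh : MemLp h 2 volume) :
    MemLp (shiftedSpectrum lam mu h) 2 volume := by
  refine (hh.comp_measurePreserving (measurePreserving_sub_right volume lam)).of_le
    (aestronglyMeasurable_shiftedSpectrum lam mu hh.1) (Eventually.of_forall fun y => le_of_eq ?_)
  rw [shiftedSpectrum, norm_mul, norm_exp_shiftedSpectrum, one_mul]
  rfl

theorem fourierInv_shiftedSpectrum (lam mu : ℝ) (h : ℝ → ℂ) :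
    𝓕⁻ (shiftedSpectrum lam mu h) = tfShiftFun lam mu (𝓕⁻ h) := by
  ext t
  rw [tfShiftFun, Real.fourierInv_eq', Real.fourierInv_eq', ← integral_const_mul,
    ← integral_add_right_eq_self _ lam]
  refine integral_congr_ae (Eventually.of_forall fun y => ?_)
  simp only [shiftedSpectrum, smul_eq_mul, add_sub_cancel_right, RCLike.inner_apply, conj_trivial]
  rw [← mul_assoc, ← mul_assoc (Complex.exp (2 * Real.pi * Complex.I * lam * t)),
    ← Complex.exp_add, ← Complex.exp_add]
  congr 2
  push_cast; ring

theorem memLp_fourierInv {h : ℝ → ℂ} (h1 : Integrable h) (h2 : MemLp h 2 volume) :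
    MemLp (𝓕⁻ h) 2 volume :=
  (memLp_congr_ae (fourierInv_toLp_ae_eq h1 h2)).1 (Lp.memLp _)

theorem tfShift_fourierInv (lam mu : ℝ) {h : ℝ → ℂ} (h1 : Integrable h) (h2 : MemLp h 2 volume)
    (hg : MemLp (𝓕⁻ h) 2 volume) :
    tfShift lam mu (hg.toLp (𝓕⁻ h)) =
      (𝓕⁻ ((memLp_shiftedSpectrum lam mu h2).toLp (shiftedSpectrum lam mu h)) : L2R) := by
  refine Lp.ext ?_
  have e1 := fourierInv_toLp_ae_eq (integrable_shiftedSpectrum lam mu h1)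
    (memLp_shiftedSpectrum lam mu h2)
  have e2 := (memLp_tfShiftFun lam mu (Lp.memLp (hg.toLp (𝓕⁻ h)))).coeFn_toLp
  have e3 := (measurePreserving_sub_right volume mu).quasiMeasurePreserving.ae hg.coeFn_toLp
  filter_upwards [e1, e2, e3] with t h1 h2 h3
  rw [h1, tfShift, h2, fourierInv_shiftedSpectrum, tfShiftFun, tfShiftFun, h3]

/-- The Gabor coefficients on the frequency side; `u` is the conjugate of the Fourier transform of
`f`, and the unimodular factor `e^{2πiλμ}` disappears in the absolute value. -/
theorem exists_enorm_inner_tfShift_eq {h : ℝ → ℂ} (h1 : Integrable h) (h2 : MemLp h 2 volume)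
    (hg : MemLp (𝓕⁻ h) 2 volume) (f : L2R) :
    ∃ u : ℝ → ℂ, Measurable u ∧ MemLp u 2 volume ∧ ∫⁻ y, ‖u y‖ₑ ^ 2 = ‖f‖ₑ ^ 2 ∧
      ∀ lam mu : ℝ, ‖(inner ℂ (tfShift lam mu (hg.toLp (𝓕⁻ h))) f : ℂ)‖ₑ =
        ‖∫ y : ℝ, Complex.exp (-2 * Real.pi * Complex.I * mu * y) * (u y * h (y - lam))‖ₑ := by
  have hFm : Measurable ((𝓕 f : L2R) : ℝ → ℂ) := (Lp.stronglyMeasurable _).measurable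
  have hstar : ∀ z : ℂ, ‖star z‖ₑ = ‖z‖ₑ := fun z => by
    rw [← ofReal_norm, norm_star, ofReal_norm]
  refine ⟨fun y => star ((𝓕 f : L2R) y), continuous_star.measurable.comp hFm, ?_, ?_, ?_⟩
  · exact (Lp.memLp (𝓕 f : L2R)).star
  · rw [← Lp.norm_fourier_eq f |> fun e => (by rw [← ofReal_norm, e, ofReal_norm] :
      ‖(𝓕 f : L2R)‖ₑ = ‖f‖ₑ), Lp.enorm_def,
      eLpNorm_eq_lintegral_rpow_enorm_toReal (by norm_num) (by norm_num)]
    simp only [hstar, ENNReal.toReal_ofNat]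
    rw [← ENNReal.rpow_natCast, ← ENNReal.rpow_mul]
    norm_num
  · intro lam mu
    have hsw : ‖(inner ℂ (tfShift lam mu (hg.toLp (𝓕⁻ h))) f : ℂ)‖ₑ =
        ‖(inner ℂ f (tfShift lam mu (hg.toLp (𝓕⁻ h))) : ℂ)‖ₑ := by
      rw [← ofReal_norm, norm_inner_symm, ofReal_norm]
    rw [hsw, tfShift_fourierInv lam mu h1 h2, ← Lp.inner_fourier_eq,
      FourierTransform.fourier_fourierInv_eq, L2.inner_def]
    have hc : ∫ y, inner ℂ ((𝓕 f : L2R) y)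
        (((memLp_shiftedSpectrum lam mu h2).toLp (shiftedSpectrum lam mu h)) y) =
        Complex.exp (2 * Real.pi * Complex.I * mu * lam) *
        ∫ y : ℝ, Complex.exp (-2 * Real.pi * Complex.I * mu * y) *
          (star ((𝓕 f : L2R) y) * h (y - lam)) := by
      rw [← integral_const_mul]
      refine integral_congr_ae ?_
      filter_upwards [(memLp_shiftedSpectrum lam mu h2).coeFn_toLp] with y hy
      rw [hy, shiftedSpectrum, RCLike.inner_apply]
      have : Complex.exp (-2 * Real.pi * Complex.I * mu * (y - lam)) =
          Complex.exp (2 * Real.pi * Complex.I * mu * lam) *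
            Complex.exp (-2 * Real.pi * Complex.I * mu * y) := by
        rw [← Complex.exp_add]; congr 1; ring
      rw [this, starRingEnd_apply]
      ring
    have hone : ‖Complex.exp (2 * Real.pi * Complex.I * mu * lam)‖ₑ = 1 := by
      have : (2 * Real.pi * Complex.I * mu * lam : ℂ) =
          ((2 * Real.pi * mu * lam : ℝ) : ℂ) * Complex.I := by push_cast; ring
      rw [this, ← ofReal_norm, Complex.norm_exp_ofReal_mul_I, ENNReal.ofReal_one]
    rw [hc, enorm_mul, hone, one_mul]

end

/-! ### Frame bounds -/

/-- Frame bounds for extended nonnegative reals, where the sums need no summability. -/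
theorem isFrame_of_enorm_bounds {ι H : Type*} [NormedAddCommGroup H] [InnerProductSpace ℂ H]
    {v : ι → H} {κ : ℝ} (hκ : 0 < κ) {P B : ℝ≥0∞} (hP : P ≠ ⊤) (hB : B ≠ ⊤)
    (hlow : ∀ f : H, ENNReal.ofReal κ * ‖f‖ₑ ^ 2 ≤ P * ∑' i, ‖(inner ℂ (v i) f : ℂ)‖ₑ ^ 2)
    (hupp : ∀ f : H, ∑' i, ‖(inner ℂ (v i) f : ℂ)‖ₑ ^ 2 ≤ B * ‖f‖ₑ ^ 2) : IsFrame v := by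
  have hp : 0 < P.toReal + 1 := by positivity
  -- adding `1` keeps both constants positive when `P` or `B` vanishes
  refine ⟨κ / (P.toReal + 1), B.toReal + 1, by positivity, by positivity, fun f => ?_⟩
  have hfin : ∑' i, ‖(inner ℂ (v i) f : ℂ)‖ₑ ^ 2 ≠ ⊤ :=
    ne_top_of_le_ne_top (ENNReal.mul_ne_top hB (by simp)) (hupp f)
  have hreal : ∀ i, (‖(inner ℂ (v i) f : ℂ)‖ₑ ^ 2).toReal = ‖(inner ℂ (v i) f : ℂ)‖ ^ 2 := by
    intro i
    rw [ENNReal.toReal_pow, toReal_enorm]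
  have hsum : Summable fun i => ‖(inner ℂ (v i) f : ℂ)‖ ^ 2 := by
    simpa only [hreal] using ENNReal.summable_toReal hfin
  have hT : (∑' i, ‖(inner ℂ (v i) f : ℂ)‖ₑ ^ 2).toReal = ∑' i, ‖(inner ℂ (v i) f : ℂ)‖ ^ 2 := by
    rw [ENNReal.tsum_toReal_eq (ENNReal.ne_top_of_tsum_ne_top hfin)]
    simp only [hreal]
  have hT0 : 0 ≤ ∑' i, ‖(inner ℂ (v i) f : ℂ)‖ ^ 2 := tsum_nonneg fun _ => by positivity
  have hf : (‖f‖ₑ ^ 2).toReal = ‖f‖ ^ 2 := by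
    rw [ENNReal.toReal_pow, toReal_enorm]
  refine ⟨hsum, ?_, ?_⟩
  · have h := ENNReal.toReal_mono (ENNReal.mul_ne_top hP hfin) (hlow f)
    rw [ENNReal.toReal_mul, ENNReal.toReal_mul, hT, hf, ENNReal.toReal_ofReal hκ.le] at h
    rw [div_mul_eq_mul_div, div_le_iff₀ hp]
    nlinarith
  · have h := ENNReal.toReal_mono (ENNReal.mul_ne_top hB (by simp)) (hupp f)
    rw [ENNReal.toReal_mul, hT, hf] at h
    nlinarith [sq_nonneg ‖f‖]

theorem tsum_gaborSystem_eq (g f : L2R) (Λ : Set ℝ) :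
    ∑' p : (Λ ×ˢ Set.range (fun n : ℤ => (n : ℝ)) : Set (ℝ × ℝ)),
      ‖(inner ℂ (gaborSystem g (Λ ×ˢ Set.range (fun n : ℤ => (n : ℝ))) p) f : ℂ)‖ₑ ^ 2 =
    ∑' l : Λ, ∑' n : ℤ, ‖(inner ℂ (tfShift l n g) f : ℂ)‖ₑ ^ 2 := by
  have hinj : Function.Injective fun n : ℤ => (n : ℝ) := Int.cast_injective
  rw [← ((Equiv.Set.prod Λ (Set.range fun n : ℤ => (n : ℝ))).trans
    (Equiv.prodCongr (Equiv.refl _) (Equiv.ofInjective _ hinj).symm)).symm.tsum_eq]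
  exact ENNReal.tsum_prod (f := fun (l : Λ) (n : ℤ) =>
    ‖(inner ℂ (tfShift l n g) f : ℂ)‖ₑ ^ 2)

theorem exists_norm_le_of_tsum_enorm_sq_ne_top {ι : Type*} {c : ι → ℂ}
    (h : ∑' k, ‖c k‖ₑ ^ 2 ≠ ⊤) : ∃ C : ℝ, ∀ k, ‖c k‖ ≤ C := by
  refine ⟨1 + (∑' k, ‖c k‖ₑ ^ 2).toReal, fun k => ?_⟩
  have h1 := ENNReal.toReal_mono h (ENNReal.le_tsum (f := fun k => ‖c k‖ₑ ^ 2) k)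
  rw [ENNReal.toReal_pow, toReal_enorm] at h1
  nlinarith [sq_nonneg (‖c k‖ - 1), norm_nonneg (c k)]

open FourierTransform in
/-- Lower bounds for the fibers at almost every point of the unit interval integrate to the frame
inequality. -/
theorem isFrame_gaborSystem_of_fiber_bound {W : Finset ℂ} (hre : ∀ w ∈ W, w.re ≠ 0) {A : ℂ → ℂ}
    {F : Finset ℝ} {L : ℕ} (hL : 0 < L) {κ : ℝ} (hκ : 0 < κ) {P : ℝ≥0∞} (hP : P ≠ ⊤)
    (hlow : ∀ y ∈ Set.Ioo (0 : ℝ) 1, ∀ (c : ℤ → ℂ) (C : ℝ), (∀ k, ‖c k‖ ≤ C) →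
      ENNReal.ofReal κ * ∑' k : ℤ, ‖c k‖ₑ ^ 2 ≤
        P * ∑' l : periodicSet F L, ‖fiberSum W A c (y - l)‖ₑ ^ 2)
    (hg : MemLp (𝓕⁻ (halfExpSum W A)) 2 volume) :
    IsFrame (gaborSystem (hg.toLp _)
      (periodicSet F L ×ˢ Set.range (fun n : ℤ => (n : ℝ)))) := by
  obtain ⟨H, hHt, hH⟩ := exists_tsum_enorm_halfExpSum_le hre A
  have hcount : Countable (periodicSet F L) := (countable_periodicSet F L).to_subtype
  have hmain : ∀ f : L2R, ∃ u : ℝ → ℂ, Measurable u ∧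
      ∫⁻ y in Set.Ioc (0 : ℝ) 1, ∑' k : ℤ, ‖u (y + k)‖ₑ ^ 2 = ‖f‖ₑ ^ 2 ∧
      ∑' p : (periodicSet F L ×ˢ Set.range (fun n : ℤ => (n : ℝ)) : Set (ℝ × ℝ)),
        ‖(inner ℂ (gaborSystem (hg.toLp _)
          (periodicSet F L ×ˢ Set.range (fun n : ℤ => (n : ℝ))) p) f : ℂ)‖ₑ ^ 2 =
      ∫⁻ y in Set.Ioc (0 : ℝ) 1, ∑' l : periodicSet F L,
        ‖fiberSum W A (fun k => u (y + k)) (y - l)‖ₑ ^ 2 := by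
    intro f
    obtain ⟨u, hum, huL, hun, hu⟩ := exists_enorm_inner_tfShift_eq (integrable_halfExpSum hre A)
      (memLp_halfExpSum hre A) hg f
    have hun' : ∫⁻ y in Set.Ioc (0 : ℝ) 1, ∑' k : ℤ, ‖u (y + k)‖ₑ ^ 2 = ‖f‖ₑ ^ 2 := by
      rw [← hun]
      exact (lintegral_eq_lintegral_tsum_add_int (hum.enorm.pow_const 2)).symm
    refine ⟨u, hum, hun', ?_⟩
    have hfib : ∀ l y : ℝ, ∑' k : ℤ, u (y + k) * halfExpSum W A (y + k - l) =
        fiberSum W A (fun k => u (y + k)) (y - l) := by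
      intro l y
      refine tsum_congr fun k => ?_
      congr 2; ring
    have hqm : ∀ l : ℝ, Measurable fun y => u y * halfExpSum W A (y - l) := fun l =>
      hum.mul ((measurable_halfExpSum W A).comp (by fun_prop))
    have hfm : ∀ l : ℝ, Measurable fun y => fiberSum W A (fun k => u (y + k)) (y - l) := by
      intro l
      simp only [← hfib]
      exact Measurable.tsum fun k => (hqm l).comp (by fun_prop)
    rw [tsum_gaborSystem_eq, lintegral_tsum fun l : periodicSet F L => ((hfm l).enorm.pow_const 2).aemeasurable]
    refine tsum_congr fun l => ?_
    have hle : ∫⁻ y in Set.Ioc (0 : ℝ) 1,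
        ‖fiberSum W A (fun k => u (y + k)) (y - l)‖ₑ ^ 2 ≤ H ^ 2 * ‖f‖ₑ ^ 2 := by
      rw [← hun', ← lintegral_const_mul' _ _ (ENNReal.pow_ne_top hHt)]
      refine lintegral_mono fun y => ?_
      refine le_trans ?_ (tsum_enorm_fiberSum_sub_int_le hH (fun k => u (y + k)) (y - l))
      refine le_trans (le_of_eq ?_) (ENNReal.le_tsum (0 : ℤ))
      simp
    have hpars := tsum_enorm_integral_fourier_mul (hqm l)
      (huL.integrable_mul ((memLp_halfExpSum hre A).comp_measurePreserving
        (measurePreserving_sub_right volume (l : ℝ)))) (by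
          simp only [hfib]
          exact ne_top_of_le_ne_top
            (ENNReal.mul_ne_top (ENNReal.pow_ne_top hHt) (by simp)) hle)
    simp only [hfib] at hpars
    rw [← hpars]
    refine tsum_congr fun n => ?_
    rw [hu]
    simp
  refine isFrame_of_enorm_bounds hκ hP (B := F.card * H ^ 2) (by
    exact ENNReal.mul_ne_top (by simp) (ENNReal.pow_ne_top hHt)) (fun f => ?_) (fun f => ?_)
  · obtain ⟨u, hum, hun, hu⟩ := hmain f
    rw [hu, ← hun, ← lintegral_const_mul' _ _ ENNReal.ofReal_ne_top, ← lintegral_const_mul' _ _ hP]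
    have hfinite : ∀ᵐ y ∂(volume.restrict (Set.Ioc (0 : ℝ) 1)),
        ∑' k : ℤ, ‖u (y + k)‖ₑ ^ 2 < ⊤ := by
      refine ae_lt_top' (Measurable.tsum fun k =>
        ((hum.comp (by fun_prop)).enorm.pow_const 2)).aemeasurable ?_
      rw [hun]; simp
    refine lintegral_mono_ae ?_
    filter_upwards [hfinite, ae_restrict_mem measurableSet_Ioc,
      ae_restrict_of_ae (compl_mem_ae_iff.2 (measure_singleton (1 : ℝ)))] with y hy hy1 hy2
    obtain ⟨C, hC⟩ := exists_norm_le_of_tsum_enorm_sq_ne_top hy.ne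
    exact hlow y ⟨hy1.1, lt_of_le_of_ne hy1.2 hy2⟩ _ C hC
  · obtain ⟨u, hum, hun, hu⟩ := hmain f
    rw [hu, ← hun, ← lintegral_const_mul' _ _
      (ENNReal.mul_ne_top (by simp) (ENNReal.pow_ne_top hHt))]
    exact lintegral_mono fun y => tsum_enorm_fiberSum_le hH F L hL _ y

/-! ### The frequency set -/

/-- Representatives modulo `L` of the frequency set: the integers, and for each step `θ_i` the
points `jθ_i + l`, `j < 2N`, `-1 ≤ l ≤ N`. A linear form in the unknowns uses a run of at most
`N + 1` of these points; the extra one allows for `y < jθ_i`, where the fractional part of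
`y - jθ_i` is `y - jθ_i + 1`. -/
noncomputable def freqReps (N L : ℕ) : Finset ℝ :=
  (Finset.range L).image (fun m : ℕ => (m : ℝ)) ∪
    ((Finset.range (N ^ 2 + 1) ×ˢ Finset.range (2 * N)) ×ˢ Finset.range (N + 2)).image
      (fun q => q.1.2 * stepSize N q.1.1 + (q.2 - 1))

theorem card_freqReps_le (N L : ℕ) :
    (freqReps N L).card ≤ L + (N ^ 2 + 1) * (2 * N) * (N + 2) := by
  refine (Finset.card_union_le _ _).trans (Nat.add_le_add ?_ ?_)
  · exact Finset.card_image_le.trans (by rw [Finset.card_range])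
  · exact Finset.card_image_le.trans (by simp [Finset.card_product])

theorem intCast_mem_periodicSet_freqReps (N : ℕ) {L : ℕ} (hL : 0 < L) (K : ℤ) :
    (K : ℝ) ∈ periodicSet (freqReps N L) L := by
  have hL' : (0 : ℤ) < L := by exact_mod_cast hL
  refine ⟨((K % L).toNat : ℝ), Finset.mem_union_left _ (Finset.mem_image_of_mem _ ?_), K / L, ?_⟩
  · rw [Finset.mem_range]
    have := Int.emod_lt_of_pos K hL'
    have := Int.emod_nonneg K hL'.ne'
    omega
  · have h1 : (((K % L).toNat : ℤ) : ℤ) + K / L * L = K := by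
      rw [Int.toNat_of_nonneg (Int.emod_nonneg K hL'.ne')]
      linarith [Int.emod_add_mul_ediv K L, mul_comm (K / L) (L : ℤ)]
    exact_mod_cast (congrArg (fun t : ℤ => (t : ℝ)) h1).symm

theorem mul_stepSize_add_mem_periodicSet_freqReps {N i j l : ℕ} (L : ℕ)
    (hi : i ∈ Finset.range (N ^ 2 + 1)) (hj : j < 2 * N) (hl : l < N + 2) (K : ℤ) :
    (j * stepSize N i + (l - 1) + K * L : ℝ) ∈ periodicSet (freqReps N L) L := by
  refine ⟨_, Finset.mem_union_right _ (Finset.mem_image.2 ⟨((i, j), l), ?_, rfl⟩), K, rfl⟩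
  simp only [Finset.mem_product, Finset.mem_range] at hi ⊢
  exact ⟨⟨hi, hj⟩, hl⟩

/-- The uniform lower bound for the fibers over the frequency set. The progression `jθ`,
`j < 2N`, contains `N` consecutive terms lying on the same side of `y`. -/
theorem exists_fiber_lower_bound {N : ℕ} (hN : 0 < N) {L : ℕ} (hL : 0 < L) {W : Finset ℂ}
    (hWne : W.Nonempty) (hW : W.card ≤ N) (hre : ∀ w ∈ W, w.re ≠ 0) {A : ℂ → ℂ}
    (hA : ∀ w ∈ W, A w ≠ 0) (hG : ∀ t : ℝ, t < 0 → expSum W A t ≠ 0) :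
    ∃ κ : ℝ, 0 < κ ∧ ∃ P : ℝ≥0∞, P ≠ ⊤ ∧ ∀ y ∈ Set.Ioo (0 : ℝ) 1, ∀ (c : ℤ → ℂ) (C : ℝ),
      (∀ k, ‖c k‖ ≤ C) → ENNReal.ofReal κ * ∑' k : ℤ, ‖c k‖ₑ ^ 2 ≤
        P * ∑' l : periodicSet (freqReps N L) L, ‖fiberSum W A c (y - l)‖ₑ ^ 2 := by
  obtain ⟨H, hHt, hH⟩ := exists_tsum_enorm_halfExpSum_le hre A
  obtain ⟨i, hi, hθ⟩ := exists_stepSize_injOn hN W hW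
  set θ := stepSize N i with hθdef
  have hθ0 : 0 ≤ θ := stepSize_nonneg N i
  have hnN : (shiftPoly W).natDegree ≤ N := (natDegree_shiftPoly_le W).trans hW
  obtain ⟨κ₀, hκ₀, h₀⟩ := exists_window_lower_bound hWne hW hA hG hθ L 0
  obtain ⟨κ₁, hκ₁, h₁⟩ := exists_window_lower_bound hWne hW hA hG hθ L (1 - N * θ)
  set Q : ℝ → ℝ≥0∞ := fun σ => ∑ _e ∈ windowEquations L N θ σ,
    (∑ j ∈ Finset.range ((shiftPoly W).natDegree + 1), ‖(shiftPoly W).coeff j‖ₑ ^ 2) *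
      ((shiftPoly W).natDegree + 1 : ℕ) with hQ
  have hQt : ∀ σ, Q σ ≠ ⊤ := fun σ => ENNReal.sum_ne_top.2 fun _ _ => ENNReal.mul_ne_top
    (ENNReal.sum_ne_top.2 fun _ _ => by simp) (by simp)
  have hmem : ∀ (σ : ℝ) (p : ℕ × ℝ → Prop), (∀ m < L, p (m, 0)) →
      (∀ j < N, p (0, σ - j * θ)) → (∀ j < N, p (L, σ - j * θ)) →
      ∀ e ∈ windowEquations L N θ σ, p e := by
    intro σ p h1 h2 h3 e he
    simp only [windowEquations, Finset.mem_union, Finset.mem_image, Finset.mem_range] at he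
    rcases he with ⟨m, hm, rfl⟩ | ⟨j, hj, rfl⟩ | ⟨j, hj, rfl⟩
    exacts [h1 m hm, h2 j hj, h3 j hj]
  refine ⟨min κ₀ κ₁, lt_min hκ₀ hκ₁, Q 0 + Q (1 - N * θ),
    ENNReal.add_ne_top.2 ⟨hQt _, hQt _⟩, fun y hy c C hc => ?_⟩
  have hyI : y ∈ Set.Icc (0 : ℝ) 1 := Set.Ioo_subset_Icc_self hy
  have hint : ∀ (K : ℤ) (m j : ℕ), (K * L + m - 0 + j : ℝ) ∈ periodicSet (freqReps N L) L := by
    intro K m j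
    have := intCast_mem_periodicSet_freqReps N hL (K * L + m + j)
    push_cast at this
    rwa [sub_zero]
  rcases le_or_gt (N * θ) y with hcase | hcase
  · -- `y - jθ ∈ [0, 1)` for `j < N`
    have key := le_tsum_enorm_fiberSum hHt hH hL (windowEquations L N θ 0)
      (Λ := periodicSet (freqReps N L) L) (h₀ y hyI)
      (hmem 0 (fun e => e.1 ≤ L) (fun m hm => hm.le) (fun _ _ => Nat.zero_le _)
        (fun _ _ => le_rfl))
      (by
        have hj : ∀ j < N, y + (0 - j * θ) ∈ Set.Ico (0 : ℝ) 1 := by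
          intro j hj
          have hj' : (j : ℝ) ≤ N := by exact_mod_cast hj.le
          have := mul_le_mul_of_nonneg_right hj' hθ0
          have : 0 ≤ (j : ℝ) * θ := by positivity
          exact ⟨by linarith, by linarith [hy.2]⟩
        exact hmem 0 (fun e => y + e.2 ∈ Set.Ico (0 : ℝ) 1)
          (fun m _ => by simpa using ⟨hy.1.le, hy.2⟩) hj hj)
      (by
        refine hmem 0 (fun e => ∀ K : ℤ, ∀ j ≤ (shiftPoly W).natDegree,
          (K * L + e.1 - e.2 + j : ℝ) ∈ periodicSet (freqReps N L) L)
          (fun m _ K j _ => hint K m j) (fun a ha K j hj => ?_) (fun a ha K j hj => ?_)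
        · have := mul_stepSize_add_mem_periodicSet_freqReps (l := j + 1) L hi
            (by omega : a < 2 * N) (by omega) K
          convert this using 1
          push_cast; ring
        · have := mul_stepSize_add_mem_periodicSet_freqReps (l := j + 1) L hi
            (by omega : a < 2 * N) (by omega) (K + 1)
          convert this using 1
          push_cast; ring)
      hc
    refine le_trans (mul_le_mul_left (ENNReal.ofReal_le_ofReal (min_le_left _ _)) _)
      (key.trans (mul_le_mul_left le_self_add _))
  · -- `y + 1 - (N + j)θ ∈ [0, 1)` for `j < N`
    have key := le_tsum_enorm_fiberSum hHt hH hL (windowEquations L N θ (1 - N * θ))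
      (Λ := periodicSet (freqReps N L) L) (h₁ y hyI)
      (hmem _ (fun e => e.1 ≤ L) (fun m hm => hm.le) (fun _ _ => Nat.zero_le _)
        (fun _ _ => le_rfl))
      (by
        have hj : ∀ j < N, y + (1 - N * θ - j * θ) ∈ Set.Ico (0 : ℝ) 1 := by
          intro j hj
          have h1 := mul_stepSize_lt_one (by omega : N + j < 2 * N) i
          push_cast at h1
          have : 0 ≤ (j : ℝ) * θ := by positivity
          exact ⟨by linarith [hy.1], by linarith⟩
        exact hmem _ (fun e => y + e.2 ∈ Set.Ico (0 : ℝ) 1)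
          (fun m _ => by simpa using ⟨hy.1.le, hy.2⟩) hj hj)
      (by
        refine hmem _ (fun e => ∀ K : ℤ, ∀ j ≤ (shiftPoly W).natDegree,
          (K * L + e.1 - e.2 + j : ℝ) ∈ periodicSet (freqReps N L) L)
          (fun m _ K j _ => hint K m j) (fun a ha K j hj => ?_) (fun a ha K j hj => ?_)
        · have := mul_stepSize_add_mem_periodicSet_freqReps (l := j) L hi
            (by omega : N + a < 2 * N) (by omega) K
          convert this using 1
          push_cast; ring
        · have := mul_stepSize_add_mem_periodicSet_freqReps (l := j) L hi
            (by omega : N + a < 2 * N) (by omega) (K + 1)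
          convert this using 1
          push_cast; ring)
      hc
    refine le_trans (mul_le_mul_left (ENNReal.ofReal_le_ofReal (min_le_right _ _)) _)
      (key.trans (mul_le_mul_left le_add_self _))

/-- Collecting equal frequencies and discarding zero coefficients. -/
theorem exists_finset_sum_eq {N : ℕ} (a w : Fin N → ℂ) :
    ∃ (W : Finset ℂ) (A : ℂ → ℂ), W.card ≤ N ∧ (∀ v ∈ W, ∃ k, w k = v) ∧ (∀ v ∈ W, A v ≠ 0) ∧
      ∀ φ : ℂ → ℂ, ∑ k, a k * φ (w k) = ∑ v ∈ W, A v * φ v := by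
  classical
  refine ⟨(Finset.univ.image w).filter fun v => ∑ k with w k = v, a k ≠ 0,
    fun v => ∑ k with w k = v, a k, ?_, ?_, fun v hv => (Finset.mem_filter.1 hv).2, fun φ => ?_⟩
  · exact (Finset.card_filter_le _ _).trans (Finset.card_image_le.trans (by simp))
  · intro v hv
    obtain ⟨k, -, hk⟩ := Finset.mem_image.1 (Finset.mem_filter.1 hv).1
    exact ⟨k, hk⟩
  · rw [Finset.sum_filter_of_ne fun v _ h => left_ne_zero_of_mul h,
      ← Finset.sum_fiberwise_of_maps_to (g := w) fun k _ => Finset.mem_image_of_mem w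
        (Finset.mem_univ k)]
    refine Finset.sum_congr rfl fun v _ => ?_
    rw [Finset.sum_mul]
    exact Finset.sum_congr rfl fun k hk => by rw [(Finset.mem_filter.1 hk).2]

theorem theorem1 (ε : ℝ) (hε : 0 < ε) (N : ℕ) :
    ∃ Lam : Set ℝ,
      IsIntPeriodic Lam ∧
      (∃ D : ℝ≥0∞, HasUpperDensity Lam D ∧ D ≤ ENNReal.ofReal (1 + ε)) ∧
      ∀ g ∈ simplePoleClass N, ∃ hg : MemLp g 2 (volume : Measure ℝ),
        IsFrame (gaborSystem (hg.toLp g) (Lam ×ˢ Set.range (fun n : ℤ => (n : ℝ)))) := by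
  set M : ℕ := (N ^ 2 + 1) * (2 * N) * (N + 2) with hM
  obtain ⟨L, hL⟩ := exists_nat_gt ((M + 1 : ℝ) / ε)
  have hL0 : (0 : ℝ) < L := lt_of_le_of_lt (by positivity) hL
  have hLpos : 0 < L := by exact_mod_cast hL0
  obtain ⟨F, hFc, hFI, hFe⟩ := exists_periodicSet_eq_Ico (freqReps N L) hLpos
  refine ⟨periodicSet (freqReps N L) L, isIntPeriodic_periodicSet _ hLpos,
    ⟨ENNReal.ofReal (F.card / L), ?_, ?_⟩, ?_⟩
  · rw [← hFe]
    exact hasUpperDensity_periodicSet hLpos hFI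
  · refine ENNReal.ofReal_le_ofReal ?_
    have h1 : (F.card : ℝ) ≤ L + M := by exact_mod_cast hFc.trans (card_freqReps_le N L)
    rw [div_lt_iff₀ hε] at hL
    rw [div_le_iff₀ hL0]
    linarith
  · rintro g ⟨a, w, hw, hG, hg⟩
    obtain ⟨W, B, hWc, hWw, hB, hsum⟩ := exists_finset_sum_eq a w
    have hpi : (2 * Real.pi * Complex.I : ℂ) ≠ 0 := Complex.two_pi_I_ne_zero
    -- the factor `2πi` makes `g` the inverse Fourier transform of `halfExpSum W A`
    set A : ℂ → ℂ := fun v => 2 * Real.pi * Complex.I * B v with hA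
    have hre : ∀ v ∈ W, v.re ≠ 0 := by
      intro v hv
      obtain ⟨k, rfl⟩ := hWw v hv
      exact hw k
    have hGA : ∀ t : ℝ, t < 0 → expSum W A t ≠ 0 := by
      intro t ht h0
      apply hG t ht
      rw [hsum fun v => Complex.exp (2 * Real.pi * v * t)]
      refine (mul_eq_zero.1 (Eq.trans ?_ h0)).resolve_left hpi
      rw [expSum, Finset.mul_sum]
      exact Finset.sum_congr rfl fun v _ => by rw [hA]; ring
    have hWne : W.Nonempty := by
      rw [Finset.nonempty_iff_ne_empty]
      rintro rfl
      exact hGA (-1) (by norm_num) (by simp [expSum])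
    have hN : 0 < N := lt_of_lt_of_le hWne.card_pos hWc
    have hgF : g = FourierTransform.fourierInv (halfExpSum W A) := by
      ext t
      rw [hg, fourierInv_halfExpSum hre]
      simp only [div_eq_mul_inv]
      rw [hsum fun v => ((t : ℂ) - Complex.I * v)⁻¹]
      refine Finset.sum_congr rfl fun v _ => ?_
      rw [hA]
      field_simp
    subst hgF
    obtain ⟨κ, hκ, P, hP, hlow⟩ := exists_fiber_lower_bound hN hLpos hWne hWc hre
      (fun v hv => mul_ne_zero hpi (hB v hv)) hGA
    exact ⟨memLp_fourierInv (integrable_halfExpSum hre A) (memLp_halfExpSum hre A),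
      isFrame_gaborSystem_of_fiber_bound hre hLpos hκ hP hlow _⟩
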